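/- **Setting.** Let $(\mathcal C,\otimes,1)$ be a closed symmetric monoidal category that is complete and cocomplete, and let $(\mathcal M,\boxtimes)$ be a left $\mathcal C$-actegory (a category with a coherent left action $\boxtimes:\mathcal C\times\mathcal M\to\mathcal M$) that is complete and cocomplete and such that $c\boxtimes -$ and $-\boxtimes m$ preserve colimits for all $c\in\mathcal C$, $m\in\mathcal M$. Let $Comm(\mathcal C)$ be the category of commutative monoids in $\mathcal C$ and $Aff_{\mathcal C}:=Comm(\mathcal C)^{op}$, with $Spec(a)$ the object corresponding to $a$. For $a\in Comm(\mathcal C)$ let $\mathbf{Mod}_{\mathcal M}(a)$ be the category of $a$-modules in $\mathcal M$, and for $\alpha:a\to b$ let $\alpha^*=b\boxtimes_a-:\mathbf{Mod}_{\mathcal M}(a)\to\mathbf{Mod}_{\mathcal M}(b)$ be extension of scalars, the left adjoint of restriction of scalars. * $\alpha$ is *$\mathcal M$-flat* if $\alpha^*$ preserves finite limits, and *of finite type* if $\mathrm{Hom}(b,-)$ on the coslice category $a/Comm(\mathcal C)$ preserves filtered colimits. The morphism $\alpha^{op}:Spec(b)\to Spec(a)$ is a *spectral immersion relative to $\mathcal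 M$* if $\alpha$ is an $\mathcal M$-flat epimorphism of finite type in $Comm(\mathcal C)$. * A family $\{\alpha_i^{op}:Spec(a_i)\to Spec(a)\}_{i\in I}$ is an *fpqc $\mathcal M$-cover* if every $\alpha_i$ is $\mathcal M$-flat and there is a finite $J\subseteq I$ such that $\{\alpha_j^*\}_{j\in J}$ is jointly conservative; it is a *spectral $\mathcal M$-cover* if moreover every $\alpha_i^{op}$ is a spectral immersion relative to $\mathcal M$. These covers define the fpqc and the spectral $\mathcal M$-topology on $Aff_{\mathcal C}$; let $Sh(Aff_{\mathcal C})_{\mathcal M}$ be the category of sheaves of sets for the spectral $\mathcal M$-topology (sets being taken in a universe in which $Aff_{\mathcal C}$ is small). Assume that $\mathcal M$ is *subcanonical*: every representable presheaf on $Aff_{\mathcal C}$ is a sheaf for the fpqc $\mathcal M$-topology. An *affine* is an object $Spec(a)$, identified with the sheaf it represents. * A subsheaf $F$ of an affine $X$ is *Zariski open relative to $\mathcal M$* if it is the image of $\coprod_i X_i\to X$ for some family $\{X_i\to X\}$ of spectral immersions relative to $\mathcal M$. A morphism $F\to G$ of $Sh(Aff_{\mathcal C})_{\mathcal M}$ is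 a *Zariski open immersion relative to $\mathcal M$* if for every affine $X$ and every $X\to G$ the projection $F\times_G X\to X$ is a monomorphism whose image is Zariski open relative to $\mathcal M$. * $F\in Sh(Aff_{\mathcal C})_{\mathcal M}$ is an *$\mathcal M$-scheme* if there is a family $\{X_i\to F\}_{i\in I}$ of Zariski open immersions relative to $\mathcal M$ with every $X_i$ affine such that $\coprod_i X_i\to F$ is an epimorphism in $Sh(Aff_{\mathcal C})_{\mathcal M}$. **Theorem.** An object $F\in Sh(Aff_{\mathcal C})_{\mathcal M}$ is an $\mathcal M$-scheme if and only if there exist a family $\{U_i\}_{i\in I}$ of affines and an equivalence relation $R\hookrightarrow H\times H$ on $H:=\coprod_{i\in I}U_i$ in $Sh(Aff_{\mathcal C})_{\mathcal M}$ such that 1. for all $i,j\in I$, with $R_{i,j}:=R\times_{H\times H}(U_i\times U_j)$, the composition $R_{i,j}\to U_i\times U_j\to U_i$ is a Zariski open immersion relative to $\mathcal M$; 2. for each $i\in I$, the subobject $R_{i,i}\hookrightarrow U_i\times U_i$ is the image of the diagonal $U_i\to U_i\times U_i$; 3. $F\cong H/R$, i.e. $F$ is the coequalizer in $Sh(Aff_{\mathcal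 C})_{\mathcal M}$ of the two projections $R\rightrightarrows H$. -/

import Mathlib

open CategoryTheory Limits MonoidalCategory Opposite

universe v u v' u'

namespace RelScheme
noncomputable section

section ExtensionOfScalars

open MonObj
open scoped MonoidalLeftAction

lemma mu_whisker_act {C : Type u} [Category.{v} C] [MonoidalCategory C]
    {M : Type u'} [Category.{v'} M] [MonoidalLeftAction C M] {A B : C} [MonObj B] (f : A ⟶ B)
    (m : M) :
    (αₗ B B (A ⊙ₗ m)).inv ≫ μ[B] ⊵ₗ (A ⊙ₗ m) ≫ (αₗ B A m).inv ≫ (B ◁ f ≫ μ[B]) ⊵ₗ m =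
      B ⊴ₗ ((αₗ B A m).inv ≫ (B ◁ f ≫ μ[B]) ⊵ₗ m) ≫ (αₗ B B m).inv ≫ μ[B] ⊵ₗ m := by
  have h1 : μ[B] ⊵ₗ (A ⊙ₗ m) ≫ (αₗ B A m).inv = (αₗ (B ⊗ B) A m).inv ≫ (μ[B] ▷ A) ⊵ₗ m := by
    rw [MonoidalLeftAction.whiskerRight_actionHomLeft, Iso.inv_hom_id_assoc]
  have h2 : B ⊴ₗ ((B ◁ f ≫ μ[B]) ⊵ₗ m) ≫ (αₗ B B m).inv =
      (αₗ B (B ⊗ A) m).inv ≫ (B ◁ (B ◁ f ≫ μ[B])) ⊵ₗ m := by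
    rw [MonoidalLeftAction.whiskerLeft_actionHomLeft, Iso.inv_hom_id_assoc]
  have h3 : (αₗ B B (A ⊙ₗ m)).inv ≫ (αₗ (B ⊗ B) A m).inv =
      B ⊴ₗ (αₗ B A m).inv ≫ (αₗ B (B ⊗ A) m).inv ≫ (α_ B B A).inv ⊵ₗ m := by
    rw [← cancel_epi (B ⊴ₗ (αₗ B A m).hom), ← cancel_epi (αₗ B (B ⊗ A) m).hom,
      ← cancel_epi ((α_ B B A).hom ⊵ₗ m),
      MonoidalLeftAction.associator_actionHom_assoc]
    simp
  have h4 : μ[B] ▷ A ≫ B ◁ f ≫ μ[B] = (α_ B B A).hom ≫ B ◁ (B ◁ f ≫ μ[B]) ≫ μ[B] := by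
    rw [← whisker_exchange_assoc, MonObj.mul_assoc]
    simp
  rw [reassoc_of% h1, MonoidalLeftAction.actionHomRight_comp, Category.assoc,
    reassoc_of% h2, reassoc_of% h3, ← MonoidalLeftAction.comp_actionHomLeft,
    ← MonoidalLeftAction.comp_actionHomLeft, ← MonoidalLeftAction.comp_actionHomLeft, h4,
    Iso.inv_hom_id_assoc]

lemma unit_whisker_act {C : Type u} [Category.{v} C] [MonoidalCategory C]
    {M : Type u'} [Category.{v'} M] [MonoidalLeftAction C M] {A B : C} [MonObj B] (f : A ⟶ B)
    (m : M) :
    (λₗ (A ⊙ₗ m)).inv ≫ η[B] ⊵ₗ (A ⊙ₗ m) ≫ (αₗ B A m).inv ≫ (B ◁ f ≫ μ[B]) ⊵ₗ m =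
      f ⊵ₗ m := by
  have h1 : η[B] ⊵ₗ (A ⊙ₗ m) ≫ (αₗ B A m).inv = (αₗ (𝟙_ C) A m).inv ≫ (η[B] ▷ A) ⊵ₗ m := by
    rw [MonoidalLeftAction.whiskerRight_actionHomLeft, Iso.inv_hom_id_assoc]
  have h2 : η[B] ▷ A ≫ B ◁ f ≫ μ[B] = (λ_ A).hom ≫ f := by
    rw [← whisker_exchange_assoc, MonObj.one_mul]
    simp
  rw [reassoc_of% h1, ← MonoidalLeftAction.comp_actionHomLeft, h2,
    MonoidalLeftAction.comp_actionHomLeft, MonoidalLeftAction.leftUnitor_actionHom,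
    Category.assoc, Iso.inv_hom_id_assoc, Iso.inv_hom_id_assoc]

lemma whisker_unit_act {C : Type u} [Category.{v} C] [MonoidalCategory C]
    {M : Type u'} [Category.{v'} M] [MonoidalLeftAction C M] {B : C} [MonObj B] (m : M) :
    B ⊴ₗ (λₗ m).inv ≫ B ⊴ₗ η[B] ⊵ₗ m ≫ (αₗ B B m).inv ≫ μ[B] ⊵ₗ m = 𝟙 (B ⊙ₗ m) := by
  have h1 : B ⊴ₗ η[B] ⊵ₗ m ≫ (αₗ B B m).inv = (αₗ B (𝟙_ C) m).inv ≫ (B ◁ η[B]) ⊵ₗ m := by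
    rw [MonoidalLeftAction.whiskerLeft_actionHomLeft, Iso.inv_hom_id_assoc]
  rw [reassoc_of% h1, ← MonoidalLeftAction.comp_actionHomLeft, MonObj.mul_one,
    MonoidalLeftAction.rightUnitor_actionHom, Iso.inv_hom_id_assoc,
    ← MonoidalLeftAction.actionHomRight_comp, Iso.inv_hom_id,
    MonoidalLeftAction.actionHomRight_id]

lemma desc_condition {C : Type u} [Category.{v} C] [MonoidalCategory C]
    {M : Type u'} [Category.{v'} M] [MonoidalLeftAction C M] {A B : C} [MonObj A] [MonObj B]
    (f : A ⟶ B) {m n : M} [ModObj A m] [ModObj B n] (ψ : m ⟶ n)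
    (hψ : (ModObj.smul : A ⊙ₗ m ⟶ m) ≫ ψ =
      A ⊴ₗ ψ ≫ f ⊵ₗ n ≫ (ModObj.smul : B ⊙ₗ n ⟶ n)) :
    B ⊴ₗ (ModObj.smul : A ⊙ₗ m ⟶ m) ≫ B ⊴ₗ ψ ≫ (ModObj.smul : B ⊙ₗ n ⟶ n) =
      ((αₗ B A m).inv ≫ (B ◁ f ≫ μ[B]) ⊵ₗ m) ≫ B ⊴ₗ ψ ≫ (ModObj.smul : B ⊙ₗ n ⟶ n) := by
  have h2 : (B ◁ f ≫ μ[B]) ⊵ₗ m ≫ B ⊴ₗ ψ =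
      (B ⊗ A) ⊴ₗ ψ ≫ (B ◁ f ≫ μ[B]) ⊵ₗ n := (MonoidalLeftAction.action_exchange _ _).symm
  have h3 : (αₗ B A m).inv ≫ (B ⊗ A) ⊴ₗ ψ = B ⊴ₗ A ⊴ₗ ψ ≫ (αₗ B A n).inv := by
    rw [MonoidalLeftAction.tensor_actionHomRight, Iso.inv_hom_id_assoc]
  have h4 : (αₗ B A n).inv ≫ (B ◁ f) ⊵ₗ n = B ⊴ₗ f ⊵ₗ n ≫ (αₗ B B n).inv := by
    rw [MonoidalLeftAction.whiskerLeft_actionHomLeft, Iso.inv_hom_id_assoc]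
  rw [Category.assoc, ← MonoidalLeftAction.actionHomRight_comp_assoc, hψ,
    MonoidalLeftAction.actionHomRight_comp, MonoidalLeftAction.actionHomRight_comp,
    Category.assoc, Category.assoc, reassoc_of% h2, reassoc_of% h3,
    MonoidalLeftAction.comp_actionHomLeft, Category.assoc, reassoc_of% h4,
    ModObj.mul_smul, Iso.inv_hom_id_assoc]

variable {C : Type u} [Category.{v} C] [MonoidalCategory C]
  {M : Type u'} [Category.{v'} M] [MonoidalLeftAction C M] [HasCoequalizers M]

section Construction

variable {A B : C} [MonObj A] [MonObj B] (f : A ⟶ B) (m : M) [ModObj A m]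

/-- The first of the two parallel arrows `B ⊙ (A ⊙ m) ⟶ B ⊙ m`: the action of `A` on `m`. -/
abbrev leftArrow : B ⊙ₗ A ⊙ₗ m ⟶ B ⊙ₗ m :=
  B ⊴ₗ ModObj.smul (M := A) (X := m)

/-- The second of the two parallel arrows `B ⊙ (A ⊙ m) ⟶ B ⊙ m`: the action of `A` on `B`
through `f`. -/
abbrev rightArrow : B ⊙ₗ A ⊙ₗ m ⟶ B ⊙ₗ m :=
  (αₗ B A m).inv ≫ (B ◁ f ≫ μ[B]) ⊵ₗ m

/-- The relative product `B ⊙_A m`. -/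
abbrev relProd : M := coequalizer (leftArrow (A := A) (B := B) m) (rightArrow f m)

/-- The canonical epimorphism `B ⊙ m ⟶ B ⊙_A m`. -/
abbrev relProdπ : B ⊙ₗ m ⟶ relProd f m := coequalizer.π _ _

lemma relProd_condition :
    B ⊴ₗ leftArrow (A := A) (B := B) m ≫ (αₗ B B m).inv ≫ μ[B] ⊵ₗ m ≫ relProdπ f m =
      B ⊴ₗ rightArrow f m ≫ (αₗ B B m).inv ≫ μ[B] ⊵ₗ m ≫ relProdπ f m := by
  have h1 : B ⊴ₗ leftArrow (A := A) (B := B) m ≫ (αₗ B B m).inv ≫ μ[B] ⊵ₗ m =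
      (αₗ B B (A ⊙ₗ m)).inv ≫ μ[B] ⊵ₗ (A ⊙ₗ m) ≫ leftArrow (A := A) (B := B) m := by
    rw [leftArrow, ← MonoidalLeftAction.action_exchange,
      MonoidalLeftAction.tensor_actionHomRight]
    simp only [Category.assoc, Iso.inv_hom_id_assoc]
  rw [reassoc_of% h1, coequalizer.condition]
  have h2 := mu_whisker_act f m =≫ relProdπ f m
  simpa only [Category.assoc] using h2

variable [PreservesColimitsOfShape WalkingParallelPair (MonoidalLeftAction.actionLeft M B)]

/-- `B ⊙ -` maps the coequalizer defining `B ⊙_A m` to a coequalizer. -/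
def isColimitActRelProd : IsColimit (Cofork.ofπ (B ⊴ₗ relProdπ f m)
    (by rw [← MonoidalLeftAction.actionHomRight_comp, coequalizer.condition,
      MonoidalLeftAction.actionHomRight_comp]) :
      Cofork (B ⊴ₗ leftArrow (A := A) (B := B) m) (B ⊴ₗ rightArrow f m)) :=
  isColimitOfHasCoequalizerOfPreservesColimit (MonoidalLeftAction.actionLeft M B)
    (leftArrow (A := A) (B := B) m) (rightArrow f m)

instance epi_act_relProdπ : Epi (B ⊴ₗ relProdπ f m) :=
  Cofork.IsColimit.epi (isColimitActRelProd f m)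

/-- The action `B ⊙ (B ⊙_A m) ⟶ B ⊙_A m`. -/
def relProdSMul : B ⊙ₗ relProd f m ⟶ relProd f m :=
  Cofork.IsColimit.desc (isColimitActRelProd f m)
    ((αₗ B B m).inv ≫ μ[B] ⊵ₗ m ≫ relProdπ f m) (relProd_condition f m)

lemma act_π_smul : B ⊴ₗ relProdπ f m ≫ relProdSMul f m =
    (αₗ B B m).inv ≫ μ[B] ⊵ₗ m ≫ relProdπ f m :=
  Cofork.IsColimit.π_desc' (isColimitActRelProd f m) _ _

lemma relProd_one_smul : η[B] ⊵ₗ relProd f m ≫ relProdSMul f m = (λₗ (relProd f m)).hom := by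
  have : Epi ((𝟙_ C) ⊴ₗ relProdπ f m) := by
    rw [MonoidalLeftAction.unit_actionHomRight]
    infer_instance
  rw [← cancel_epi ((𝟙_ C) ⊴ₗ relProdπ f m), MonoidalLeftAction.action_exchange_assoc,
    act_π_smul, ← MonoidalLeftAction.actionUnitIso_hom_naturality]
  have h : η[B] ⊵ₗ (B ⊙ₗ m) ≫ (αₗ B B m).inv ≫ μ[B] ⊵ₗ m = (λₗ (B ⊙ₗ m)).hom := by
    have h1 : η[B] ⊵ₗ (B ⊙ₗ m) ≫ (αₗ B B m).inv =
        (αₗ (𝟙_ C) B m).inv ≫ (η[B] ▷ B) ⊵ₗ m := by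
      rw [MonoidalLeftAction.whiskerRight_actionHomLeft, Iso.inv_hom_id_assoc]
    rw [reassoc_of% h1, ← MonoidalLeftAction.comp_actionHomLeft, MonObj.one_mul,
      MonoidalLeftAction.leftUnitor_actionHom, Iso.inv_hom_id_assoc]
  rw [reassoc_of% h]

lemma relProd_mul_smul : μ[B] ⊵ₗ relProd f m ≫ relProdSMul f m =
    (αₗ B B (relProd f m)).hom ≫ B ⊴ₗ relProdSMul f m ≫ relProdSMul f m := by
  have h0 : Epi (B ⊴ₗ B ⊴ₗ relProdπ f m) :=
    Cofork.IsColimit.epi (isColimitCoforkMapOfIsColimit (MonoidalLeftAction.actionLeft M B) _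
      (isColimitActRelProd f m))
  have : Epi ((B ⊗ B) ⊴ₗ relProdπ f m) := by
    rw [MonoidalLeftAction.tensor_actionHomRight]
    infer_instance
  rw [← cancel_epi ((B ⊗ B) ⊴ₗ relProdπ f m), MonoidalLeftAction.action_exchange_assoc,
    act_π_smul, MonoidalLeftAction.tensor_actionHomRight]
  simp only [Category.assoc, Iso.inv_hom_id_assoc]
  rw [← MonoidalLeftAction.actionHomRight_comp_assoc, act_π_smul]
  simp only [MonoidalLeftAction.actionHomRight_comp, Category.assoc, act_π_smul]
  have h := (αₗ B B (B ⊙ₗ m)).hom ≫= mu_whisker_act (𝟙 B) m =≫ relProdπ f m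
  simpa only [MonoidalCategory.whiskerLeft_id, Category.id_comp, Category.assoc,
    Iso.hom_inv_id_assoc, MonoidalLeftAction.actionHomRight_comp] using h


/-- The `B`-module structure of `B ⊙_A m`. -/
abbrev relProdModObj : ModObj B (relProd f m) where
  smul := relProdSMul f m
  one_smul := relProd_one_smul f m
  mul_smul := relProd_mul_smul f m

/-- The unit `m ⟶ B ⊙_A m`. -/
def relProdUnit : m ⟶ relProd f m :=
  (λₗ m).inv ≫ η[B] ⊵ₗ m ≫ relProdπ f m

lemma whisker_unit_smul :
    B ⊴ₗ relProdUnit f m ≫ relProdSMul f m = relProdπ f m := by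
  have h2 := whisker_unit_act (B := B) m =≫ relProdπ f m
  simp only [relProdUnit, MonoidalLeftAction.actionHomRight_comp, Category.assoc,
    Category.id_comp, act_π_smul] at h2 ⊢
  exact h2

lemma smul_relProdUnit :
    (ModObj.smul : A ⊙ₗ m ⟶ m) ≫ relProdUnit f m =
      A ⊴ₗ relProdUnit f m ≫ f ⊵ₗ relProd f m ≫ relProdSMul f m := by
  have h2 : (ModObj.smul : A ⊙ₗ m ⟶ m) ≫ (λₗ m).inv =
      (λₗ (A ⊙ₗ m)).inv ≫ (𝟙_ C) ⊴ₗ (ModObj.smul : A ⊙ₗ m ⟶ m) :=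
    (MonoidalLeftAction.actionUnitIso_inv_naturality _).symm
  rw [MonoidalLeftAction.action_exchange_assoc, whisker_unit_smul, relProdUnit, reassoc_of% h2,
    MonoidalLeftAction.action_exchange_assoc, coequalizer.condition]
  have h3 := unit_whisker_act f m =≫ relProdπ f m
  simpa only [Category.assoc] using h3

variable {m} {n : M} [ModObj B n]

lemma smul_relProdUnit_comp (φ : relProd f m ⟶ n)
    (hφ : relProdSMul f m ≫ φ = B ⊴ₗ φ ≫ (ModObj.smul : B ⊙ₗ n ⟶ n)) :
    (ModObj.smul : A ⊙ₗ m ⟶ m) ≫ relProdUnit f m ≫ φ =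
      A ⊴ₗ (relProdUnit f m ≫ φ) ≫ f ⊵ₗ n ≫ (ModObj.smul : B ⊙ₗ n ⟶ n) := by
  have h := smul_relProdUnit f m =≫ φ
  simp only [Category.assoc, hφ] at h
  rw [h, MonoidalLeftAction.actionHomRight_comp, Category.assoc,
    MonoidalLeftAction.action_exchange_assoc f φ]

variable (ψ : m ⟶ n) (hψ : (ModObj.smul : A ⊙ₗ m ⟶ m) ≫ ψ =
  A ⊴ₗ ψ ≫ f ⊵ₗ n ≫ (ModObj.smul : B ⊙ₗ n ⟶ n))

/-- The morphism `B ⊙_A m ⟶ n` induced by an `A`-linear morphism `m ⟶ n`. -/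
def relProdDesc : relProd f m ⟶ n :=
  coequalizer.desc (B ⊴ₗ ψ ≫ (ModObj.smul : B ⊙ₗ n ⟶ n)) (desc_condition f ψ hψ)

set_option linter.unusedSectionVars false in
lemma π_relProdDesc :
    relProdπ f m ≫ relProdDesc f ψ hψ = B ⊴ₗ ψ ≫ (ModObj.smul : B ⊙ₗ n ⟶ n) :=
  coequalizer.π_desc _ _

lemma smul_relProdDesc :
    relProdSMul f m ≫ relProdDesc f ψ hψ =
      B ⊴ₗ relProdDesc f ψ hψ ≫ (ModObj.smul : B ⊙ₗ n ⟶ n) := by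
  have h3 : (αₗ B B m).inv ≫ (B ⊗ B) ⊴ₗ ψ = B ⊴ₗ B ⊴ₗ ψ ≫ (αₗ B B n).inv := by
    rw [MonoidalLeftAction.tensor_actionHomRight, Iso.inv_hom_id_assoc]
  rw [← cancel_epi (B ⊴ₗ relProdπ f m), reassoc_of% (act_π_smul f m), π_relProdDesc,
    ← MonoidalLeftAction.actionHomRight_comp_assoc, π_relProdDesc,
    ← MonoidalLeftAction.action_exchange_assoc, reassoc_of% h3, ModObj.mul_smul,
    Iso.inv_hom_id_assoc, MonoidalLeftAction.actionHomRight_comp, Category.assoc]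

lemma unit_relProdDesc : relProdUnit f m ≫ relProdDesc f ψ hψ = ψ := by
  rw [relProdUnit, Category.assoc, Category.assoc, π_relProdDesc,
    ← MonoidalLeftAction.action_exchange_assoc, ModObj.one_smul,
    ← MonoidalLeftAction.actionUnitIso_hom_naturality, Iso.inv_hom_id_assoc]

lemma relProdDesc_unit (φ : relProd f m ⟶ n)
    (hφ : relProdSMul f m ≫ φ = B ⊴ₗ φ ≫ (ModObj.smul : B ⊙ₗ n ⟶ n)) :
    relProdDesc f (relProdUnit f m ≫ φ) (smul_relProdUnit_comp f φ hφ) = φ := by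
  apply coequalizer.hom_ext
  refine (π_relProdDesc f _ (smul_relProdUnit_comp f φ hφ)).trans ?_
  have h := whisker_unit_smul f m =≫ φ
  rw [MonoidalLeftAction.actionHomRight_comp, Category.assoc, ← hφ, ← h, Category.assoc]

end Construction

variable {A B : C} [MonObj A] [MonObj B] (f : A ⟶ B)
  [PreservesColimitsOfShape WalkingParallelPair (MonoidalLeftAction.actionLeft M B)]

/-- Extension of scalars on objects: `m ↦ B ⊙_A m` with its `B`-module structure. -/
def extendObj (m : Mod M A) : Mod M B :=
  letI := relProdModObj f m.X
  ⟨relProd f m.X⟩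

variable [IsMonHom f]

/-- The bijection `Hom_B(B ⊙_A m, n) ≃ Hom_A(m, n)`. -/
def extendHomEquiv (m : Mod M A) (n : Mod M B) :
    (extendObj f m ⟶ n) ≃ (m ⟶ (Mod.comap f).obj n) where
  toFun φ := Mod.Hom.mk' (N := (Mod.comap f).obj n) (relProdUnit f m.X ≫ φ.hom)
    (smul_relProdUnit_comp f φ.hom φ.isModHom.smul_hom)
  invFun ψ := Mod.Hom.mk' (M := extendObj f m)
    (relProdDesc f (n := n.X) ψ.hom ψ.isModHom.smul_hom)
    (smul_relProdDesc f (n := n.X) ψ.hom ψ.isModHom.smul_hom)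
  left_inv φ := Mod.hom_ext _ _ (relProdDesc_unit f φ.hom φ.isModHom.smul_hom)
  right_inv ψ := Mod.hom_ext _ _ (unit_relProdDesc f (n := n.X) ψ.hom ψ.isModHom.smul_hom)

variable (M) in
/-- Extension of scalars `Mod_M(A) ⥤ Mod_M(B)`, `m ↦ B ⊙_A m`, along a morphism of monoids. It is
left adjoint to restriction of scalars. -/
def extendScalars : Mod M A ⥤ Mod M B :=
  Adjunction.leftAdjointOfEquiv (G := Mod.comap f) (extendHomEquiv f) (by
    intro m n n' g h
    apply Mod.hom_ext
    exact (Category.assoc _ _ _).symm)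

variable (M) in
/-- Extension of scalars is left adjoint to restriction of scalars. -/
def extendScalarsAdjunction : extendScalars M f ⊣ Mod.comap f :=
  Adjunction.adjunctionOfEquivLeft (extendHomEquiv f) _

end ExtensionOfScalars

section Topology

variable (C : Type u) [Category.{v} C] [MonoidalCategory C] [BraidedCategory C]

/-- The category of affine schemes over `C`: the opposite of the category of commutative monoids
in `C`. -/
abbrev Aff : Type (max u v) := (CommMon C)ᵒᵖ

variable {C}

/-- A morphism `α : a ⟶ b` of commutative monoids is of finite type if
`Hom(b, -) : a/Comm(C) ⥤ Set` preserves (small) filtered colimits. -/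
def IsFiniteType {a b : CommMon C} (α : a ⟶ b) : Prop :=
  PreservesFilteredColimitsOfSize.{v, v} (coyoneda.obj (op (Under.mk α)))

variable (M : Type u') [Category.{v'} M] [MonoidalLeftAction C M] [HasCoequalizers M]
  [∀ c : C, PreservesColimitsOfShape WalkingParallelPair (MonoidalLeftAction.actionLeft M c)]

instance isMonHom_hom {a b : CommMon C} (α : a ⟶ b) :
    IsMonHom (M := a.X) (N := b.X) α.hom.hom :=
  α.hom.isMonHom_hom

/-- The extension of scalars functor `α^* : Mod_M(a) ⥤ Mod_M(b)` along a morphism of commutative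
monoids. -/
abbrev pullbackMod {a b : CommMon C} (α : a ⟶ b) : Mod M a.X ⥤ Mod M b.X :=
  extendScalars M (A := a.X) (B := b.X) α.hom.hom

/-- `M`-flatness: `α^*` preserves finite limits. -/
def IsFlat {a b : CommMon C} (α : a ⟶ b) : Prop :=
  PreservesFiniteLimits (pullbackMod M α)

/-- A family of morphisms of affine schemes is an fpqc `M`-cover if its members are `M`-flat and
some finite subfamily of the extension of scalars functors is jointly conservative. -/
structure IsFpqcCover {I : Type*} {X : Aff C} {Y : I → Aff C} (f : ∀ i, Y i ⟶ X) : Prop where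
  flat : ∀ i, IsFlat M (f i).unop
  conservative : ∃ J : Finset I, ∀ ⦃m n : Mod M X.unop.X⦄ (φ : m ⟶ n),
    (∀ j ∈ J, IsIso ((pullbackMod M (f j).unop).map φ)) → IsIso φ

/-- A morphism of affine schemes is a spectral immersion relative to `M` if it corresponds to an
`M`-flat epimorphism of finite type of commutative monoids. -/
structure IsSpectralImmersion {Y X : Aff C} (f : Y ⟶ X) : Prop where
  flat : IsFlat M f.unop
  epi : Epi f.unop
  finiteType : IsFiniteType f.unop

/-- A spectral `M`-cover is an fpqc `M`-cover by spectral immersions. -/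
structure IsSpectralCover {I : Type*} {X : Aff C} {Y : I → Aff C} (f : ∀ i, Y i ⟶ X) : Prop where
  fpqc : IsFpqcCover M f
  immersion : ∀ i, IsSpectralImmersion M (f i)

variable (C)

/-- The fpqc `M`-covers. -/
def fpqcPrecoverage : Precoverage (Aff C) where
  coverings X := {R | ∃ (I : Type (max u v)) (Y : I → Aff C) (f : ∀ i, Y i ⟶ X),
    IsFpqcCover M f ∧ R = Presieve.ofArrows Y f}

/-- The spectral `M`-covers. -/
def spectralPrecoverage : Precoverage (Aff C) where
  coverings X := {R | ∃ (I : Type (max u v)) (Y : I → Aff C) (f : ∀ i, Y i ⟶ X),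
    IsSpectralCover M f ∧ R = Presieve.ofArrows Y f}

/-- The fpqc `M`-topology: the Grothendieck topology generated by the fpqc `M`-covers. -/
def fpqcTopology : GrothendieckTopology (Aff C) := (fpqcPrecoverage C M).toGrothendieck

/-- The spectral `M`-topology: the Grothendieck topology generated by the spectral `M`-covers. -/
def spectralTopology : GrothendieckTopology (Aff C) := (spectralPrecoverage C M).toGrothendieck

lemma spectralTopology_le_fpqcTopology : spectralTopology C M ≤ fpqcTopology C M :=
  Precoverage.toGrothendieck_mono (by
    rintro X R ⟨I, Y, f, hf, rfl⟩
    exact ⟨I, Y, f, hf.fpqc, rfl⟩)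

/-- The actegory `M` is subcanonical if every representable presheaf on `Aff C` is a sheaf for the
fpqc `M`-topology. -/
class IsSubcanonical : Prop where
  subcanonical : (fpqcTopology C M).Subcanonical

instance spectral_subcanonical [h : IsSubcanonical C M] : (spectralTopology C M).Subcanonical :=
  have := h.subcanonical
  .of_le (spectralTopology_le_fpqcTopology C M)

end Topology

section Schemes

variable (C : Type u) [Category.{v} C] [MonoidalCategory C] [BraidedCategory C]
  (M : Type u') [Category.{v'} M] [MonoidalLeftAction C M] [HasCoequalizers M]
  [∀ c : C, PreservesColimitsOfShape WalkingParallelPair (MonoidalLeftAction.actionLeft M c)]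

/-- Sheaves of sets on `Aff C` for the spectral `M`-topology. Sets live in a universe in which
`Aff C` is small. -/
abbrev SpectralSheaf := Sheaf (spectralTopology C M) (Type (max u v))

/-! The usual exactness properties of a category of sheaves, at the universe levels used here. -/

theorem hasSheafify_aux {D : Type u} [Category.{v} D] (J : GrothendieckTopology D) :
    HasSheafify J (Type (max u v)) :=
  inferInstance

theorem hasColimits_aux {D : Type u} [Category.{v} D] (J : GrothendieckTopology D)
    [HasSheafify J (Type u')] : HasColimitsOfSize.{u', u'} (Sheaf J (Type u')) :=
  Sheaf.instHasColimitsOfSize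

theorem hasLimits_aux {D : Type u} [Category.{v} D] (J : GrothendieckTopology D) :
    HasLimitsOfSize.{u', u'} (Sheaf J (Type u')) :=
  inferInstance

instance hasSheafify_spectral : HasSheafify (spectralTopology C M) (Type (max u v)) :=
  hasSheafify_aux.{v, max u v} _

instance hasColimits_spectral : HasColimitsOfSize.{max u v, max u v} (SpectralSheaf C M) :=
  hasColimits_aux.{v, max u v, max u v} _

instance hasLimits_spectral : HasLimitsOfSize.{max u v, max u v} (SpectralSheaf C M) :=
  hasLimits_aux.{v, max u v, max u v} _

variable [IsSubcanonical C M]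

/-- The Yoneda embedding of affine schemes into spectral sheaves. -/
abbrev affine : Aff C ⥤ SpectralSheaf C M :=
  GrothendieckTopology.uliftYoneda.{max u v} (spectralTopology C M)

variable {C M}

/-- A morphism `j : F ⟶ X` to an affine scheme is the inclusion of a Zariski open (relative to
`M`) if it is a monomorphism and `F` is the image of `∐ Xᵢ ⟶ X` for some family of spectral
immersions `Xᵢ ⟶ X`. -/
def IsZariskiOpen {X : Aff C} {F : SpectralSheaf C M} (j : F ⟶ (affine C M).obj X) : Prop :=
  Mono j ∧ ∃ (I : Type (max u v)) (Y : I → Aff C) (α : ∀ i, Y i ⟶ X),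
    (∀ i, IsSpectralImmersion M (α i)) ∧
    ∃ p : (∐ fun i => (affine C M).obj (Y i)) ⟶ F,
      Epi p ∧ p ≫ j = Limits.Sigma.desc fun i => (affine C M).map (α i)

/-- A morphism of sheaves is a Zariski open immersion relative to `M` if its base change along any
morphism from an affine scheme is the inclusion of a Zariski open. -/
def IsZariskiOpenImmersion {F G : SpectralSheaf C M} (f : F ⟶ G) : Prop :=
  ∀ (X : Aff C) (x : (affine C M).obj X ⟶ G), IsZariskiOpen (pullback.snd f x)

/-- An affine Zariski `M`-covering of `F`. -/
structure IsAffineZariskiCovering {F : SpectralSheaf C M} {I : Type (max u v)} {X : I → Aff C}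
    (f : ∀ i, (affine C M).obj (X i) ⟶ F) : Prop where
  openImmersion : ∀ i, IsZariskiOpenImmersion (f i)
  epi : Epi (Limits.Sigma.desc f)

/-- A sheaf is an `M`-scheme if it has an affine Zariski `M`-covering. -/
def IsScheme (F : SpectralSheaf C M) : Prop :=
  ∃ (I : Type (max u v)) (X : I → Aff C) (f : ∀ i, (affine C M).obj (X i) ⟶ F),
    IsAffineZariskiCovering f

end Schemes

section EquivalenceRelations

variable {D : Type*} [Category* D] [HasFiniteProducts D] [HasPullbacks D]

/-- `r : R ⟶ H × H` is an (internal) equivalence relation on `H`. -/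
structure IsEquivalenceRelation {R H : D} (r : R ⟶ H ⨯ H) : Prop where
  mono : Mono r
  refl : ∃ d : H ⟶ R, d ≫ r = diag H
  symm : ∃ s : R ⟶ R, s ≫ r = r ≫ prod.lift prod.snd prod.fst
  trans : ∃ t : pullback (r ≫ prod.snd) (r ≫ prod.fst) ⟶ R,
    t ≫ r = prod.lift (pullback.fst _ _ ≫ r ≫ prod.fst) (pullback.snd _ _ ≫ r ≫ prod.snd)

variable {I : Type*} (U : I → D) [HasCoproduct U] {R : D} (r : R ⟶ (∐ U) ⨯ (∐ U))

/-- The restriction `R i j = R ×_{H × H} (U i × U j)` of a relation `R` on `H = ∐ U`. -/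
abbrev relComponent (i j : I) : D :=
  pullback r (prod.map (Limits.Sigma.ι U i) (Limits.Sigma.ι U j))

/-- The canonical morphism `R i j ⟶ U i × U j`. -/
abbrev relComponentMap (i j : I) : relComponent U r i j ⟶ U i ⨯ U j :=
  pullback.snd r (prod.map (Limits.Sigma.ι U i) (Limits.Sigma.ι U j))

end EquivalenceRelations

end
end RelScheme

/-! Write `H = ∐ U i` and `π : H ⟶ F`. Both directions compare `R` with the kernel pair of `π`,
whose `(i, j)` component is the fibre product of `U i` and `U j` over `F`.

From a scheme to a quotient the argument is formal. An affine Zariski covering makes `π` an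
epimorphism of sheaves, hence the coequalizer of its kernel pair `R`. The projection from `R i j` to
`U i` is a base change of `U j ⟶ F`, so it is an open immersion. Since `U i ⟶ F` is a monomorphism,
`R i i` is the diagonal.

Conversely, equivalence relations of sheaves are effective (`IsEquivalenceRelation.isPullback`), so
`R` is the kernel pair of the quotient map, and trivial diagonal components make each `U i ⟶ F` a
monomorphism. It remains to see that this map is an open immersion
(`isZariskiOpenImmersion_of_isPullback`). A point `X ⟶ F` lifts locally, over maps `Y ⟶ X`, to some
`U j`. There the preimage of `U i` is a pullback of `R j i ⟶ U j`, hence the image of spectral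
immersions `Z ⟶ Y`. The composites `Z ⟶ Y ⟶ X` exhibit the preimage of `U i` in `X` as Zariski open,
provided that the maps `Y ⟶ X` can be chosen to be spectral immersions.

That choice is the main work (`generate_spectralPart_mem`), because the topology is only generated
by the spectral covers. The sieves already covering by their spectral members form a topology as
soon as spectral immersions are stable under composition and base change. Base change needs the
pushout of commutative monoids, built as a reflexive coequalizer, and the comparison of `B ⊙_A n`
with `(B ⊗_A E) ⊙_E n` (`baseChangeIso`), which transports flatness. For epimorphisms, finite type
is a factorization property, and its stability is checked by diagram arguments. -/

namespace RelScheme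
noncomputable section

set_option linter.unusedSectionVars false

/-! ### Epimorphisms, monomorphisms and quotients of sheaves through local lifting of points -/

section SheafExactness

universe v₀ u₀ w
variable {D : Type u₀} [Category.{v₀} D] (J : GrothendieckTopology D)

/-- Sections identified by sheafification already agree locally. This supplies the hypothesis `hJ`
of `IsEquivalenceRelation.exists_lift` at the universe level of spectral sheaves. -/
lemma isLocallyInjective_toSheafify_of_max {D : Type u} [Category.{v} D]
    (J : GrothendieckTopology D) (P : Dᵒᵖ ⥤ Type (max u v)) [HasSheafify J (Type (max u v))] :
    Presheaf.IsLocallyInjective J (toSheafify J P) :=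
  inferInstance

variable [J.Subcanonical]

variable {J}

/-- The equality of generalized points of a sheaf can be checked locally. -/
lemma hom_ext_of_mem {F : Sheaf J (Type (max v₀ w))} {X : D} {S : Sieve X} (hS : S ∈ J X)
    {x x' : (GrothendieckTopology.uliftYoneda.{w} J).obj X ⟶ F}
    (h : ∀ ⦃Y : D⦄ (g : Y ⟶ X), S g →
      (GrothendieckTopology.uliftYoneda.{w} J).map g ≫ x =
        (GrothendieckTopology.uliftYoneda.{w} J).map g ≫ x') :
    x = x' := by
  apply (J.uliftYonedaEquiv).injective
  refine (((isSheaf_iff_isSheaf_of_type _ _).mp F.property).isSeparated S hS).ext ?_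
  intro Y g hg
  rw [J.uliftYonedaEquiv_naturality, J.uliftYonedaEquiv_naturality, h g hg]

/-- A family of morphisms of sheaves is jointly epimorphic if generalized points lift locally. -/
lemma epi_sigmaDesc_of_locally_lift {F : Sheaf J (Type (max v₀ w))} {I : Type*}
    {U : I → Sheaf J (Type (max v₀ w))} [HasCoproduct U] (f : ∀ i, U i ⟶ F)
    (h : ∀ (X : D) (x : (GrothendieckTopology.uliftYoneda.{w} J).obj X ⟶ F),
      ∃ S ∈ J X, ∀ ⦃Y : D⦄ (g : Y ⟶ X), S g →
      ∃ (i : I) (z : (GrothendieckTopology.uliftYoneda.{w} J).obj Y ⟶ U i),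
        z ≫ f i = (GrothendieckTopology.uliftYoneda.{w} J).map g ≫ x) :
    Epi (Limits.Sigma.desc f) where
  left_cancellation {G} a b hab := by
    apply J.hom_ext_uliftYoneda
    intro X x
    obtain ⟨S, hS, hx⟩ := h X x
    refine hom_ext_of_mem hS fun Y g hg => ?_
    obtain ⟨i, z, hz⟩ := hx g hg
    have := Limits.Sigma.ι U i ≫= hab
    rw [Limits.Sigma.ι_desc_assoc, Limits.Sigma.ι_desc_assoc] at this
    rw [← Category.assoc, ← Category.assoc, ← hz, Category.assoc, Category.assoc, this]

/-- Morphisms out of `F` are determined by their values on points from representables, and, their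
target being a sheaf, by those values on a cover, where the points come from `G`. -/
lemma epi_of_locally_lift {F G : Sheaf J (Type (max v₀ w))} (f : G ⟶ F)
    (h : ∀ (X : D) (x : (GrothendieckTopology.uliftYoneda.{w} J).obj X ⟶ F),
      ∃ S ∈ J X, ∀ ⦃Y : D⦄ (g : Y ⟶ X), S g →
      ∃ z : (GrothendieckTopology.uliftYoneda.{w} J).obj Y ⟶ G,
        z ≫ f = (GrothendieckTopology.uliftYoneda.{w} J).map g ≫ x) :
    Epi f where
  left_cancellation {G} a b hab := by
    apply J.hom_ext_uliftYoneda
    intro X x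
    obtain ⟨S, hS, hx⟩ := h X x
    refine hom_ext_of_mem hS fun Y g hg => ?_
    obtain ⟨z, hz⟩ := hx g hg
    rw [← Category.assoc, ← Category.assoc, ← hz, Category.assoc, Category.assoc, hab]

variable [HasSheafify J (Type (max v₀ w))]

/-- The points of the target of a jointly epimorphic family lift locally. -/
lemma locally_lift_of_epi_sigmaDesc {F : Sheaf J (Type (max v₀ w))} {I : Type*}
    {U : I → Sheaf J (Type (max v₀ w))} [HasCoproduct U] (f : ∀ i, U i ⟶ F)
    [Epi (Limits.Sigma.desc f)] {X : D} (x : (GrothendieckTopology.uliftYoneda.{w} J).obj X ⟶ F) :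
    ∃ S ∈ J X, ∀ ⦃Y : D⦄ (g : Y ⟶ X), S g →
      ∃ (i : I) (z : (GrothendieckTopology.uliftYoneda.{w} J).obj Y ⟶ U i),
        z ≫ f i = (GrothendieckTopology.uliftYoneda.{w} J).map g ≫ x := by
  -- `T` is the union of the presheaf images. Its sheafification inside `F` is a subsheaf through
  -- which every `f i` factors, so its inclusion is both mono and epi, hence all of `F`.
  let T : Subfunctor F.obj := ⨆ i, Subfunctor.range (f i).hom
  have hF := (isSheaf_iff_isSheaf_of_type _ _).mp F.property
  let T' : Sheaf J (Type (max v₀ w)) :=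
    ⟨(T.sheafify J).toFunctor, (isSheaf_iff_isSheaf_of_type _ _).mpr (T.sheafify_isSheaf hF)⟩
  let j : T' ⟶ F := ⟨(T.sheafify J).ι⟩
  have hle : ∀ i, Subfunctor.range (f i).hom ≤ T.sheafify J := fun i =>
    (le_iSup (fun i => Subfunctor.range (f i).hom) i).trans (T.le_sheafify J)
  let l : ∀ i, U i ⟶ T' := fun i => ⟨Subfunctor.lift (f i).hom (hle i)⟩
  have hl : ∀ i, l i ≫ j = f i := fun i => by
    apply ObjectProperty.hom_ext
    exact Subfunctor.lift_ι _ (hle i)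
  have hm : Mono j := (sheafToPresheaf J _).mono_of_mono_map (by
    change Mono (T.sheafify J).ι
    infer_instance)
  have he : Epi j := by
    have : Limits.Sigma.desc l ≫ j = Limits.Sigma.desc f := by
      ext i
      simp [hl]
    exact epi_of_epi_fac this
  have hi : IsIso j := isIso_of_mono_of_epi j
  have htop : T.sheafify J = ⊤ := by
    rw [Subfunctor.eq_top_iff_isIso]
    exact inferInstanceAs (IsIso ((sheafToPresheaf J _).map j))
  have hx : J.uliftYonedaEquiv x ∈ (T.sheafify J).obj (op X) := by
    rw [htop]
    trivial
  -- The covering sieve consists of the arrows along which the section restricts into `T`, that is,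
  -- into one of the images.
  refine ⟨_, hx, fun Y g hg => ?_⟩
  change F.obj.map g.op (J.uliftYonedaEquiv x) ∈ T.obj (op Y) at hg
  rw [Subfunctor.iSup_obj] at hg
  obtain ⟨i, t, ht⟩ := Set.mem_iUnion.mp hg
  refine ⟨i, J.uliftYonedaEquiv.symm t, ?_⟩
  apply J.uliftYonedaEquiv.injective
  rw [J.uliftYonedaEquiv_comp, Equiv.apply_symm_apply, ← J.uliftYonedaEquiv_naturality]
  exact ht

/-- Factoring a generalized point through a monomorphism is a local question. -/
lemma exists_lift_of_locally_lift {F G : Sheaf J (Type (max v₀ w))} (j : G ⟶ F) [Mono j] {X : D}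
    (x : (GrothendieckTopology.uliftYoneda.{w} J).obj X ⟶ F) {S : Sieve X} (hS : S ∈ J X)
    (h : ∀ ⦃Y : D⦄ (g : Y ⟶ X), S g →
      ∃ z : (GrothendieckTopology.uliftYoneda.{w} J).obj Y ⟶ G, z ≫ j =
        (GrothendieckTopology.uliftYoneda.{w} J).map g ≫ x) :
    ∃ z : (GrothendieckTopology.uliftYoneda.{w} J).obj X ⟶ G, z ≫ j = x := by
  -- The pullback of `j` along `x` is mono, and the local lifts make it epi, so it is invertible and
  -- its inverse gives the global lift.
  have : Epi (pullback.snd j x) := by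
    apply epi_of_locally_lift
    intro X' x'
    obtain ⟨k, rfl⟩ := (GrothendieckTopology.uliftYoneda.{w} J).map_surjective x'
    refine ⟨S.pullback k, J.pullback_stable k hS, fun Y g hg => ?_⟩
    obtain ⟨z, hz⟩ := h (g ≫ k) hg
    refine ⟨pullback.lift z
      ((GrothendieckTopology.uliftYoneda.{w} J).map g ≫ (GrothendieckTopology.uliftYoneda.{w} J).map k)
      (by rw [hz, Functor.map_comp]), ?_⟩
    rw [pullback.lift_snd]
  have : IsIso (pullback.snd j x) := isIso_of_mono_of_epi _
  refine ⟨inv (pullback.snd j x) ≫ pullback.fst j x, ?_⟩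
  rw [Category.assoc, pullback.condition, IsIso.inv_hom_id_assoc]

/-- Equivalence relations of sheaves are effective: points of `H` that are identified by the
coequalizer of an equivalence relation `R` are related by `R`. -/
lemma IsEquivalenceRelation.exists_lift
    (hJ : ∀ P : Dᵒᵖ ⥤ Type (max v₀ w), Presheaf.IsLocallyInjective J (toSheafify J P))
    {R H F : Sheaf J (Type (max v₀ w))} {r : R ⟶ H ⨯ H}
    (hr : IsEquivalenceRelation r) {π : H ⟶ F} (hπ : (r ≫ prod.fst) ≫ π = (r ≫ prod.snd) ≫ π)
    (hc : IsColimit (Cofork.ofπ π hπ)) {X : D}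
    {x x' : (GrothendieckTopology.uliftYoneda.{w} J).obj X ⟶ H} (hx : x ≫ π = x' ≫ π) :
    ∃ t : (GrothendieckTopology.uliftYoneda.{w} J).obj X ⟶ R, t ≫ r = prod.lift x x' := by
  have hmono := hr.mono
  -- The relation induced by `R` on sections; `hρ` translates it into lifts of pairs of points
  -- through `r`.
  let ρ : ∀ Y : Dᵒᵖ, H.obj.obj Y → H.obj.obj Y → Prop := fun Y a b =>
    ∃ t : R.obj.obj Y, (r ≫ prod.fst).hom.app Y t = a ∧ (r ≫ prod.snd).hom.app Y t = b
  have hρ : ∀ (Y : D) (a b : (GrothendieckTopology.uliftYoneda.{w} J).obj Y ⟶ H),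
      ρ (op Y) (J.uliftYonedaEquiv a) (J.uliftYonedaEquiv b) ↔
        ∃ t : (GrothendieckTopology.uliftYoneda.{w} J).obj Y ⟶ R, t ≫ r = prod.lift a b := by
    intro Y a b
    constructor
    · rintro ⟨t, h1, h2⟩
      refine ⟨J.uliftYonedaEquiv.symm t, ?_⟩
      ext1
      · apply J.uliftYonedaEquiv.injective
        rw [Category.assoc, J.uliftYonedaEquiv_comp, Equiv.apply_symm_apply, h1, prod.lift_fst]
      · apply J.uliftYonedaEquiv.injective
        rw [Category.assoc, J.uliftYonedaEquiv_comp, Equiv.apply_symm_apply, h2, prod.lift_snd]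
    · rintro ⟨t, ht⟩
      refine ⟨J.uliftYonedaEquiv t, ?_, ?_⟩
      · rw [← J.uliftYonedaEquiv_comp, reassoc_of% ht, prod.lift_fst]
      · rw [← J.uliftYonedaEquiv_comp, reassoc_of% ht, prod.lift_snd]
  have heq : ∀ Y : D, Equivalence (ρ (op Y)) := by
    intro Y
    refine ⟨fun a => ?_, fun {a b} h => ?_, fun {a b c} h h' => ?_⟩
    · obtain ⟨a, rfl⟩ := J.uliftYonedaEquiv.surjective a
      obtain ⟨d, hd⟩ := hr.refl
      refine (hρ Y a a).mpr ⟨a ≫ d, ?_⟩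
      rw [Category.assoc, hd]
      ext1 <;> simp
    · obtain ⟨a, rfl⟩ := J.uliftYonedaEquiv.surjective a
      obtain ⟨b, rfl⟩ := J.uliftYonedaEquiv.surjective b
      obtain ⟨s, hs⟩ := hr.symm
      obtain ⟨t, ht⟩ := (hρ Y a b).mp h
      refine (hρ Y b a).mpr ⟨t ≫ s, ?_⟩
      rw [Category.assoc, hs, reassoc_of% ht]
      ext1
      · rw [Category.assoc, prod.lift_fst, prod.lift_fst, prod.lift_snd]
      · rw [Category.assoc, prod.lift_snd, prod.lift_snd, prod.lift_fst]
    · obtain ⟨a, rfl⟩ := J.uliftYonedaEquiv.surjective a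
      obtain ⟨b, rfl⟩ := J.uliftYonedaEquiv.surjective b
      obtain ⟨c, rfl⟩ := J.uliftYonedaEquiv.surjective c
      obtain ⟨m, hm⟩ := hr.trans
      obtain ⟨t, ht⟩ := (hρ Y a b).mp h
      obtain ⟨t', ht'⟩ := (hρ Y b c).mp h'
      have hw : t ≫ r ≫ prod.snd = t' ≫ r ≫ prod.fst := by
        rw [reassoc_of% ht, reassoc_of% ht', prod.lift_snd, prod.lift_fst]
      refine (hρ Y a c).mpr ⟨pullback.lift t t' hw ≫ m, ?_⟩
      rw [Category.assoc, hm]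
      ext1
      · rw [Category.assoc, prod.lift_fst, prod.lift_fst, pullback.lift_fst_assoc]
        exact ht =≫ prod.fst |>.trans (prod.lift_fst _ _) |> (Category.assoc _ _ _).symm.trans
      · rw [Category.assoc, prod.lift_snd, prod.lift_snd, pullback.lift_snd_assoc]
        exact ht' =≫ prod.snd |>.trans (prod.lift_snd _ _) |> (Category.assoc _ _ _).symm.trans
  -- The sectionwise quotient of `H`. Its sheafification receives a map `k` from `H` that
  -- coequalizes `R`, so `k` factors through `π`, and points identified by `π` are identified by
  -- `k`.
  let Q : Dᵒᵖ ⥤ Type (max v₀ w) :=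
    { obj := fun Y => Quot (ρ Y)
      map := fun {Y Z} g => ↾(Quot.map (H.obj.map g) (by
        rintro a b ⟨t, rfl, rfl⟩
        refine ⟨R.obj.map g t, ?_, ?_⟩
        · exact NatTrans.naturality_apply (r ≫ prod.fst).hom g t
        · exact NatTrans.naturality_apply (r ≫ prod.snd).hom g t))
      map_id := fun Y => by
        ext ⟨a⟩
        change Quot.mk _ _ = Quot.mk _ _
        simp
      map_comp := fun f g => by
        ext ⟨a⟩
        change Quot.mk _ _ = Quot.mk _ _
        simp }
  let q : H.obj ⟶ Q :=
    { app := fun Y => ↾(Quot.mk (ρ Y))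
      naturality := fun Y Z g => rfl }
  let k : H ⟶ (presheafToSheaf J _).obj Q := ⟨q ≫ toSheafify J Q⟩
  have hk : (r ≫ prod.fst) ≫ k = (r ≫ prod.snd) ≫ k := by
    apply ObjectProperty.hom_ext
    have : (r ≫ prod.fst).hom ≫ q = (r ≫ prod.snd).hom ≫ q := by
      ext Y t
      exact Quot.sound ⟨t, rfl, rfl⟩
    change (r ≫ prod.fst).hom ≫ q ≫ toSheafify J Q = (r ≫ prod.snd).hom ≫ q ≫ toSheafify J Q
    rw [reassoc_of% this]
  have hkx : x ≫ k = x' ≫ k := by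
    have h : π ≫ Cofork.IsColimit.desc hc k hk = k := Cofork.IsColimit.π_desc' hc k hk
    rw [← h, reassoc_of% hx]
  have hkx' : (toSheafify J Q).app (op X) (q.app (op X) (J.uliftYonedaEquiv x)) =
      (toSheafify J Q).app (op X) (q.app (op X) (J.uliftYonedaEquiv x')) := by
    have := congrArg J.uliftYonedaEquiv hkx
    rw [J.uliftYonedaEquiv_comp, J.uliftYonedaEquiv_comp] at this
    exact this
  have := hJ Q
  -- Locally the two points have the same class in `Q`, hence are related by `R` because `ρ` is an
  -- equivalence relation. As `r` is mono, these local lifts glue.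
  have hS := Presheaf.equalizerSieve_mem J (toSheafify J Q) _ _ hkx'
  refine exists_lift_of_locally_lift r _ hS fun Y g hg => ?_
  have hg' : Quot.mk (ρ (op Y)) (H.obj.map g.op (J.uliftYonedaEquiv x)) =
    Quot.mk (ρ (op Y)) (H.obj.map g.op (J.uliftYonedaEquiv x')) := hg
  rw [J.uliftYonedaEquiv_naturality, J.uliftYonedaEquiv_naturality] at hg'
  have := (hρ Y _ _).mp (((heq Y).quot_mk_eq_iff _ _).mp hg')
  rwa [prod.comp_lift]

end SheafExactness

/-! ### Limits of modules and functoriality of extension of scalars -/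

section ModuleLimits

open MonObj
open scoped MonoidalLeftAction

variable {C : Type u} [Category.{v} C] [MonoidalCategory C]
  {M : Type u'} [Category.{v'} M] [MonoidalLeftAction C M]

lemma unit_act_act {B : C} [MonObj B] (m : M) :
    η[B] ⊵ₗ (B ⊙ₗ m) ≫ (αₗ B B m).inv ≫ μ[B] ⊵ₗ m = (λₗ (B ⊙ₗ m)).hom := by
  have h1 : η[B] ⊵ₗ (B ⊙ₗ m) ≫ (αₗ B B m).inv =
      (αₗ (𝟙_ C) B m).inv ≫ (η[B] ▷ B) ⊵ₗ m := by
    rw [MonoidalLeftAction.whiskerRight_actionHomLeft, Iso.inv_hom_id_assoc]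
  rw [reassoc_of% h1, ← MonoidalLeftAction.comp_actionHomLeft, MonObj.one_mul,
    MonoidalLeftAction.leftUnitor_actionHom, Iso.inv_hom_id_assoc]

/-- The free module `A ⊙ m`. -/
abbrev freeModObj (A : C) [MonObj A] (m : M) : ModObj A (A ⊙ₗ m) where
  smul := (αₗ A A m).inv ≫ μ[A] ⊵ₗ m
  one_smul := unit_act_act m
  mul_smul := by
    have h := (αₗ A A (A ⊙ₗ m)).hom ≫= mu_whisker_act (𝟙 A) m
    simpa only [MonoidalCategory.whiskerLeft_id, Category.id_comp, Category.assoc,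
      Iso.hom_inv_id_assoc, MonoidalLeftAction.actionHomRight_comp] using h

lemma smul_free_desc {A : C} [MonObj A] {m n : M} [ModObj A n] (ψ : m ⟶ n) :
    ((αₗ A A m).inv ≫ μ[A] ⊵ₗ m) ≫ A ⊴ₗ ψ ≫ (ModObj.smul : A ⊙ₗ n ⟶ n) =
      A ⊴ₗ (A ⊴ₗ ψ ≫ (ModObj.smul : A ⊙ₗ n ⟶ n)) ≫ (ModObj.smul : A ⊙ₗ n ⟶ n) := by
  have h3 : (αₗ A A m).inv ≫ (A ⊗ A) ⊴ₗ ψ = A ⊴ₗ A ⊴ₗ ψ ≫ (αₗ A A n).inv := by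
    rw [MonoidalLeftAction.tensor_actionHomRight, Iso.inv_hom_id_assoc]
  rw [Category.assoc, ← MonoidalLeftAction.action_exchange_assoc, reassoc_of% h3,
    ModObj.mul_smul, Iso.inv_hom_id_assoc, MonoidalLeftAction.actionHomRight_comp,
    Category.assoc]

lemma free_desc_unit {A : C} [MonObj A] {m n : M} [ModObj A n] (φ : A ⊙ₗ m ⟶ n)
    (hφ : ((αₗ A A m).inv ≫ μ[A] ⊵ₗ m) ≫ φ = A ⊴ₗ φ ≫ (ModObj.smul : A ⊙ₗ n ⟶ n)) :
    A ⊴ₗ ((λₗ m).inv ≫ η[A] ⊵ₗ m ≫ φ) ≫ (ModObj.smul : A ⊙ₗ n ⟶ n) = φ := by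
  have h2 := whisker_unit_act (B := A) m =≫ φ
  simp only [Category.assoc, Category.id_comp] at h2 hφ
  rw [MonoidalLeftAction.actionHomRight_comp, MonoidalLeftAction.actionHomRight_comp,
    Category.assoc, Category.assoc, ← hφ]
  exact h2

lemma unit_free_desc {A : C} [MonObj A] {m n : M} [ModObj A n] (ψ : m ⟶ n) :
    (λₗ m).inv ≫ η[A] ⊵ₗ m ≫ A ⊴ₗ ψ ≫ (ModObj.smul : A ⊙ₗ n ⟶ n) = ψ := by
  rw [← MonoidalLeftAction.action_exchange_assoc, ModObj.one_smul,
    ← MonoidalLeftAction.actionUnitIso_hom_naturality, Iso.inv_hom_id_assoc]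

/-- The free module on an object, as a bundled module. -/
def freeMod (A : C) [MonObj A] (m : M) : Mod M A :=
  letI := freeModObj A m
  ⟨A ⊙ₗ m⟩

/-- The bijection `Hom_A(A ⊙ m, n) ≃ Hom(m, n)`. -/
def freeModHomEquiv (A : C) [MonObj A] (m : M) (n : Mod M A) :
    (freeMod A m ⟶ n) ≃ (m ⟶ n.X) where
  toFun φ := (λₗ m).inv ≫ η[A] ⊵ₗ m ≫ φ.hom
  invFun ψ := Mod.Hom.mk' (M := freeMod A m) (A ⊴ₗ ψ ≫ (ModObj.smul : A ⊙ₗ n.X ⟶ n.X))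
    (smul_free_desc ψ)
  left_inv φ := Mod.hom_ext _ _ (free_desc_unit φ.hom φ.isModHom.smul_hom)
  right_inv ψ := unit_free_desc ψ

/-- The left adjoint is the free module. Together with reflection of limits, this lets limit
preservation be tested on underlying objects. -/
instance forget_isRightAdjoint (A : C) [MonObj A] : (Mod.forget A : Mod M A ⥤ M).IsRightAdjoint :=
  (Adjunction.adjunctionOfEquivLeft (G := Mod.forget A) (freeModHomEquiv A) (by
    intro m n n' g h
    exact (((λₗ m).inv ≫= Category.assoc _ _ _).symm.trans
      (Category.assoc _ _ _).symm))).isRightAdjoint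

/-- Linearity of `f` holds after composing with a linear `g` whenever `f ≫ g` is linear. With `g`
ranging over the projections of a limit cone, the induced morphism is linear. -/
lemma smul_comp_of_comp {A : C} [MonObj A] {l m n : M} [ModObj A l] [ModObj A m] [ModObj A n]
    {f : l ⟶ m} {g : m ⟶ n} {k : l ⟶ n} [IsModHom A g] [IsModHom A k] (h : f ≫ g = k) :
    ((ModObj.smul : A ⊙ₗ l ⟶ l) ≫ f) ≫ g = (A ⊴ₗ f ≫ (ModObj.smul : A ⊙ₗ m ⟶ m)) ≫ g := by
  rw [Category.assoc, h, Category.assoc, IsModHom.smul_hom (f := g), IsModHom.smul_hom (f := k),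
    ← h, MonoidalLeftAction.actionHomRight_comp, Category.assoc]

lemma smul_comp_id {X : C} {m : M} {s t : X ⊙ₗ m ⟶ m} (h : s = t) :
    s ≫ 𝟙 m = X ⊴ₗ 𝟙 m ≫ t := by
  rw [h, Category.comp_id, MonoidalLeftAction.actionHomRight_id, Category.id_comp]

lemma id_act_smul {A : C} [MonObj A] (m : M) [ModObj A m] :
    (𝟙 A) ⊵ₗ m ≫ (ModObj.smul : A ⊙ₗ m ⟶ m) = ModObj.smul := by
  rw [MonoidalLeftAction.id_actionHomLeft, Category.id_comp]

lemma comp_act_smul {A B E : C} [MonObj E] (f : A ⟶ B) (g : B ⟶ E) (m : M) [ModObj E m] :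
    (f ≫ g) ⊵ₗ m ≫ (ModObj.smul : E ⊙ₗ m ⟶ m) = f ⊵ₗ m ≫ g ⊵ₗ m ≫ ModObj.smul := by
  rw [MonoidalLeftAction.comp_actionHomLeft, Category.assoc]

universe w₁ w₂

/-- A cone of modules is a limit cone if its underlying cone is. -/
instance forget_reflectsLimits (A : C) [MonObj A] {J : Type w₁} [Category.{w₂} J] :
    ReflectsLimitsOfShape J (Mod.forget A : Mod M A ⥤ M) where
  reflectsLimit {K} :=
    { reflects := fun {c} hc => ⟨
        { lift := fun s => Mod.Hom.mk' (hc.lift ((Mod.forget A).mapCone s)) (by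
            apply hc.hom_ext
            intro j
            have h2 : hc.lift ((Mod.forget A).mapCone s) ≫ (c.π.app j).hom = (s.π.app j).hom :=
              hc.fac _ j
            exact smul_comp_of_comp (A := A) (l := s.pt.X) (m := c.pt.X) (n := (K.obj j).X)
              (f := hc.lift ((Mod.forget A).mapCone s)) (g := (c.π.app j).hom) h2)
          fac := fun s j => Mod.hom_ext _ _ (hc.fac _ j)
          uniq := fun s m hm => Mod.hom_ext _ _ (hc.uniq ((Mod.forget A).mapCone s) m.hom
            (fun j => congrArg Mod.Hom.hom (hm j))) }⟩ }

variable [HasCoequalizers M]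

section

variable {A B : C} [MonObj A] [MonObj B] (f : A ⟶ B) [IsMonHom f]
  [PreservesColimitsOfShape WalkingParallelPair (MonoidalLeftAction.actionLeft M B)]

instance comap_isRightAdjoint : (Mod.comap f : Mod M B ⥤ Mod M A).IsRightAdjoint :=
  (extendScalarsAdjunction M f).isRightAdjoint

/-- On morphisms `extendScalars` is defined through the adjunction bijection; this recovers the
concrete description, induced by `φ` on `B ⊙ m`, needed for naturality of base change. -/
lemma relProdπ_extendScalars_map {m n : Mod M A} (φ : m ⟶ n) :
    relProdπ f m.X ≫ ((extendScalars M f).map φ).hom = B ⊴ₗ φ.hom ≫ relProdπ f n.X := by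
  have h : ((extendScalars M f).map φ).hom =
      relProdDesc f (n := (extendObj f n).X) (φ.hom ≫ relProdUnit f n.X ≫ 𝟙 _)
        (φ ≫ extendHomEquiv f n _ (𝟙 (extendObj f n))).isModHom.smul_hom := rfl
  have h1 : φ.hom ≫ relProdUnit f n.X ≫ 𝟙 _ = φ.hom ≫ relProdUnit f n.X := by
    rw [Category.comp_id]
  rw [h]
  refine (π_relProdDesc f (n := (extendObj f n).X) _ _).trans ?_
  refine (congrArg (fun t => B ⊴ₗ t ≫ relProdSMul f n.X) h1).trans ?_
  rw [MonoidalLeftAction.actionHomRight_comp, Category.assoc, whisker_unit_smul]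

/-- Extension of scalars along an identity. -/
def extendScalarsId [PreservesColimitsOfShape WalkingParallelPair
    (MonoidalLeftAction.actionLeft M A)] : extendScalars M (𝟙 A) ≅ 𝟭 (Mod M A) :=
  (extendScalarsAdjunction M (𝟙 A)).leftAdjointUniq
    (Adjunction.id.ofNatIsoRight (NatIso.ofComponents (fun m =>
      { hom := Mod.Hom.mk' (N := (Mod.comap (𝟙 A)).obj m) (𝟙 m.X)
          (smul_comp_id (id_act_smul _).symm)
        inv := Mod.Hom.mk' (M := (Mod.comap (𝟙 A)).obj m) (𝟙 m.X) (smul_comp_id (id_act_smul _))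
        hom_inv_id := Mod.hom_ext _ _ (Category.comp_id _)
        inv_hom_id := Mod.hom_ext _ _ (Category.comp_id _) })
      (fun _ => Mod.hom_ext _ _ ((Category.comp_id _).trans (Category.id_comp _).symm))))

/-- Extension of scalars along a composition. -/
def extendScalarsComp {E : C} [MonObj E] (g : B ⟶ E) [IsMonHom g]
    [PreservesColimitsOfShape WalkingParallelPair (MonoidalLeftAction.actionLeft M E)] :
    extendScalars M (f ≫ g) ≅ extendScalars M f ⋙ extendScalars M g :=
  -- Restricting along `f ≫ g` or in two steps gives the same action on the same object, so
  -- identities are linear both ways, and left adjoints are unique.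
  (extendScalarsAdjunction M (f ≫ g)).leftAdjointUniq
    (((extendScalarsAdjunction M f).comp (extendScalarsAdjunction M g)).ofNatIsoRight
      (NatIso.ofComponents (fun m =>
        { hom := Mod.Hom.mk' (M := (Mod.comap g ⋙ Mod.comap f).obj m)
            (N := (Mod.comap (f ≫ g)).obj m) (𝟙 m.X) (smul_comp_id (comp_act_smul f g m.X).symm)
          inv := Mod.Hom.mk' (M := (Mod.comap (f ≫ g)).obj m)
            (N := (Mod.comap g ⋙ Mod.comap f).obj m) (𝟙 m.X) (smul_comp_id (comp_act_smul f g m.X))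
          hom_inv_id := Mod.hom_ext _ _ (Category.comp_id _)
          inv_hom_id := Mod.hom_ext _ _ (Category.comp_id _) })
        (fun _ => Mod.hom_ext _ _ ((Category.comp_id _).trans (Category.id_comp _).symm))))

end

end ModuleLimits

/-! ### Pushouts of commutative monoids as reflexive coequalizers -/

section CommMonPushout

open MonObj

variable {C : Type u} [Category.{v} C] [MonoidalCategory C] [SymmetricCategory C]

lemma isMonHom_one (B : C) [MonObj B] : IsMonHom η[B] where
  one_hom := Category.id_comp _
  mul_hom := by
    change (λ_ (𝟙_ C)).hom ≫ η[B] = _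
    rw [MonoidalCategory.tensorHom_def, Category.assoc, MonObj.mul_one, rightUnitor_naturality,
      unitors_equal]

/-- Commutativity gives `(xy)(zw) = (xz)(yw)`, which is multiplicativity of the multiplication. -/
lemma isMonHom_mul (B : C) [MonObj B] [IsCommMonObj B] : IsMonHom μ[B] where
  one_hom := by
    change ((λ_ (𝟙_ C)).inv ≫ (η[B] ⊗ₘ η[B])) ≫ μ[B] = _
    rw [MonoidalCategory.tensorHom_def, Category.assoc, Category.assoc, MonObj.mul_one,
      rightUnitor_naturality, ← unitors_equal, Iso.inv_hom_id_assoc]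
  mul_hom := by
    change (tensorμ B B B B ≫ (μ[B] ⊗ₘ μ[B])) ≫ μ[B] = _
    rw [Category.assoc, MonObj.mul_mul_mul_comm]

variable [MonoidalClosed C]

instance epi_whiskerLeft {X Y Z : C} (p : X ⟶ Y) [Epi p] : Epi (Z ◁ p) :=
  inferInstanceAs (Epi ((tensorLeft Z).map p))

instance epi_whiskerRight {X Y Z : C} (p : X ⟶ Y) [Epi p] : Epi (p ▷ Z) :=
  inferInstanceAs (Epi ((tensorRight Z).map p))

instance epi_tensorHom {X Y X' Y' : C} (p : X ⟶ Y) (q : X' ⟶ Y') [Epi p] [Epi q] :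
    Epi (p ⊗ₘ q) := by
  rw [MonoidalCategory.tensorHom_def]
  infer_instance

variable [HasCoequalizers C]

section Coequalizer

variable {A B : C} (f g : A ⟶ B)

/-- Tensoring on the left with `X` preserves the coequalizer of `f` and `g`. -/
def isColimitWhiskerLeft (X : C) : IsColimit (Cofork.ofπ (X ◁ coequalizer.π f g)
    (by rw [← MonoidalCategory.whiskerLeft_comp, coequalizer.condition,
      MonoidalCategory.whiskerLeft_comp]) : Cofork (X ◁ f) (X ◁ g)) :=
  isColimitOfHasCoequalizerOfPreservesColimit (tensorLeft X) f g

/-- Tensoring on the right with `X` preserves the coequalizer of `f` and `g`. -/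
def isColimitWhiskerRight (X : C) : IsColimit (Cofork.ofπ (coequalizer.π f g ▷ X)
    (by rw [← comp_whiskerRight, coequalizer.condition, comp_whiskerRight]) :
      Cofork (f ▷ X) (g ▷ X)) :=
  isColimitOfHasCoequalizerOfPreservesColimit (tensorRight X) f g

variable [MonObj A] [MonObj B] [IsMonHom f] [IsMonHom g]

/-- For `k` equal to `f` or `g`, the common section gives `b · k(a) = k(s(b) · a)`, and `f`, `g`
agree after `coequalizer.π`. This is the use of reflexivity. -/
lemma whiskerLeft_mul_coequalizer {s : B ⟶ A} (hf : s ≫ f = 𝟙 B) (hg : s ≫ g = 𝟙 B) :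
    (B ◁ f) ≫ μ[B] ≫ coequalizer.π f g = (B ◁ g) ≫ μ[B] ≫ coequalizer.π f g := by
  have h (k : A ⟶ B) [IsMonHom k] (hk : s ≫ k = 𝟙 B) : (B ◁ k) ≫ μ[B] = s ▷ A ≫ μ[A] ≫ k := by
    rw [IsMonHom.mul_hom, MonoidalCategory.tensorHom_def, Category.assoc,
      ← comp_whiskerRight_assoc, hk,
      id_whiskerRight, Category.id_comp]
  rw [reassoc_of% h f hf, reassoc_of% h g hg, coequalizer.condition]

/-- The action of `B` on a reflexive coequalizer of morphisms of monoids `A ⟶ B`. -/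
def coequalizerAct (h : ∃ s : B ⟶ A, s ≫ f = 𝟙 B ∧ s ≫ g = 𝟙 B) :
    B ⊗ coequalizer f g ⟶ coequalizer f g :=
  Cofork.IsColimit.desc (isColimitWhiskerLeft f g B) (μ[B] ≫ coequalizer.π f g)
    (whiskerLeft_mul_coequalizer f g h.choose_spec.1 h.choose_spec.2)

lemma whiskerLeft_coequalizerAct (h : ∃ s : B ⟶ A, s ≫ f = 𝟙 B ∧ s ≫ g = 𝟙 B) :
    B ◁ coequalizer.π f g ≫ coequalizerAct f g h = μ[B] ≫ coequalizer.π f g :=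
  Cofork.IsColimit.π_desc' (isColimitWhiskerLeft f g B) _ _

/-- The mirror computation `k(a) · b = k(a · s(b))`, tested on the epimorphism `A ◁ coequalizer.π f
g`. It lets the action of `B` descend in its first variable too. -/
lemma whiskerRight_coequalizerAct (h : ∃ s : B ⟶ A, s ≫ f = 𝟙 B ∧ s ≫ g = 𝟙 B) :
    f ▷ _ ≫ coequalizerAct f g h = g ▷ _ ≫ coequalizerAct f g h := by
  obtain ⟨s, hf, hg⟩ := id h
  have key (k : A ⟶ B) [IsMonHom k] (hk : s ≫ k = 𝟙 B) : k ▷ B ≫ μ[B] = A ◁ s ≫ μ[A] ≫ k := by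
    rw [IsMonHom.mul_hom, MonoidalCategory.tensorHom_def', Category.assoc,
      ← MonoidalCategory.whiskerLeft_comp_assoc, hk, MonoidalCategory.whiskerLeft_id,
      Category.id_comp]
  rw [← cancel_epi (A ◁ coequalizer.π f g), whisker_exchange_assoc, whisker_exchange_assoc,
    whiskerLeft_coequalizerAct, reassoc_of% key f hf, reassoc_of% key g hg,
    coequalizer.condition]

/-- The multiplication on a reflexive coequalizer of morphisms of monoids. -/
def coequalizerMul (h : ∃ s : B ⟶ A, s ≫ f = 𝟙 B ∧ s ≫ g = 𝟙 B) :
    coequalizer f g ⊗ coequalizer f g ⟶ coequalizer f g :=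
  Cofork.IsColimit.desc (isColimitWhiskerRight f g _) (coequalizerAct f g h)
    (whiskerRight_coequalizerAct f g h)

/-- This determines the multiplication, since a tensor product of epimorphisms is epi here; the
monoid axioms then descend from `B`. -/
lemma tensorHom_coequalizerMul (h : ∃ s : B ⟶ A, s ≫ f = 𝟙 B ∧ s ≫ g = 𝟙 B) :
    (coequalizer.π f g ⊗ₘ coequalizer.π f g) ≫ coequalizerMul f g h =
      μ[B] ≫ coequalizer.π f g := by
  have h1 : coequalizer.π f g ▷ _ ≫ coequalizerMul f g h = coequalizerAct f g h :=
    Cofork.IsColimit.π_desc' (isColimitWhiskerRight f g _) _ _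
  rw [MonoidalCategory.tensorHom_def', Category.assoc, h1, whiskerLeft_coequalizerAct]

/-- A reflexive coequalizer of monoids is a monoid. -/
abbrev coequalizerMonObj (h : ∃ s : B ⟶ A, s ≫ f = 𝟙 B ∧ s ≫ g = 𝟙 B) :
    MonObj (coequalizer f g) where
  one := η[B] ≫ coequalizer.π f g
  mul := coequalizerMul f g h
  one_mul := by
    rw [← cancel_epi ((𝟙_ C) ◁ coequalizer.π f g), ← MonoidalCategory.tensorHom_def'_assoc,
      ← whiskerRight_comp_tensorHom_assoc, tensorHom_coequalizerMul, MonObj.one_mul_assoc,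
      leftUnitor_naturality]
  mul_one := by
    rw [← cancel_epi (coequalizer.π f g ▷ (𝟙_ C)), ← MonoidalCategory.tensorHom_def_assoc,
      ← whiskerLeft_comp_tensorHom_assoc, tensorHom_coequalizerMul, MonObj.mul_one_assoc,
      rightUnitor_naturality]
  mul_assoc := by
    rw [← cancel_epi ((coequalizer.π f g ⊗ₘ coequalizer.π f g) ⊗ₘ coequalizer.π f g)]
    have h1 : ((coequalizer.π f g ⊗ₘ coequalizer.π f g) ⊗ₘ coequalizer.π f g) ≫
        coequalizerMul f g h ▷ _ = μ[B] ▷ B ≫ (coequalizer.π f g ⊗ₘ coequalizer.π f g) := by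
      rw [tensorHom_comp_whiskerRight, tensorHom_coequalizerMul, whiskerRight_comp_tensorHom]
    have h2 : (coequalizer.π f g ⊗ₘ (coequalizer.π f g ⊗ₘ coequalizer.π f g)) ≫
        _ ◁ coequalizerMul f g h = B ◁ μ[B] ≫ (coequalizer.π f g ⊗ₘ coequalizer.π f g) := by
      rw [tensorHom_comp_whiskerLeft, tensorHom_coequalizerMul, whiskerLeft_comp_tensorHom]
    rw [reassoc_of% h1, tensorHom_coequalizerMul, associator_naturality_assoc, reassoc_of% h2,
      tensorHom_coequalizerMul, MonObj.mul_assoc_assoc]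

lemma isMonHom_coequalizerπ (h : ∃ s : B ⟶ A, s ≫ f = 𝟙 B ∧ s ≫ g = 𝟙 B) :
    letI := coequalizerMonObj f g h
    IsMonHom (coequalizer.π f g) :=
  letI := coequalizerMonObj f g h
  { one_hom := rfl
    mul_hom := (tensorHom_coequalizerMul f g h).symm }

lemma isCommMonObj_coequalizer (h : ∃ s : B ⟶ A, s ≫ f = 𝟙 B ∧ s ≫ g = 𝟙 B) [IsCommMonObj B] :
    letI := coequalizerMonObj f g h
    IsCommMonObj (coequalizer f g) :=
  letI := coequalizerMonObj f g h
  { mul_comm := by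
      rw [← cancel_epi (coequalizer.π f g ⊗ₘ coequalizer.π f g)]
      change _ ≫ _ ≫ coequalizerMul f g h = _ ≫ coequalizerMul f g h
      rw [BraidedCategory.braiding_naturality_assoc, tensorHom_coequalizerMul,
        IsCommMonObj.mul_comm_assoc] }

lemma isMonHom_of_coequalizerπ_comp (h : ∃ s : B ⟶ A, s ≫ f = 𝟙 B ∧ s ≫ g = 𝟙 B) {X : C}
    [MonObj X] (k : coequalizer f g ⟶ X) [hk : IsMonHom (coequalizer.π f g ≫ k)] :
    letI := coequalizerMonObj f g h
    IsMonHom k :=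
  letI := coequalizerMonObj f g h
  { one_hom := by
      have := hk.one_hom
      rwa [← Category.assoc] at this
    mul_hom := by
      rw [← cancel_epi (coequalizer.π f g ⊗ₘ coequalizer.π f g)]
      change _ ≫ coequalizerMul f g h ≫ _ = _
      rw [reassoc_of% (tensorHom_coequalizerMul f g h), hk.mul_hom,
        tensorHom_comp_tensorHom_assoc] }

end Coequalizer

section Pushout

variable {A B E : C} [MonObj A] [MonObj B] [MonObj E] (α : A ⟶ B) (β : A ⟶ E)

/-- The action of `A` on `E`, tensored with `B`. -/
abbrev pushoutLeft : B ⊗ (A ⊗ E) ⟶ B ⊗ E := B ◁ (β ▷ E ≫ μ[E])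

/-- The action of `A` on `B`, tensored with `E`. -/
abbrev pushoutRight : B ⊗ (A ⊗ E) ⟶ B ⊗ E := (α_ B A E).inv ≫ (B ◁ α ≫ μ[B]) ▷ E

/-- The common section inserts the unit of `A`: `b ⊗ e ↦ b ⊗ 1 ⊗ e`. -/
lemma pushout_reflexive [IsMonHom α] [IsMonHom β] : ∃ s : B ⊗ E ⟶ B ⊗ (A ⊗ E),
    s ≫ pushoutLeft β = 𝟙 _ ∧ s ≫ pushoutRight α = 𝟙 _ := by
  refine ⟨B ◁ ((λ_ E).inv ≫ η[A] ▷ E), ?_, ?_⟩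
  · rw [pushoutLeft, ← MonoidalCategory.whiskerLeft_comp, Category.assoc,
      ← comp_whiskerRight_assoc, IsMonHom.one_hom, MonObj.one_mul, Iso.inv_hom_id,
      MonoidalCategory.whiskerLeft_id]
  · rw [pushoutRight, MonoidalCategory.whiskerLeft_comp, Category.assoc,
      associator_inv_naturality_middle_assoc, ← comp_whiskerRight,
      ← MonoidalCategory.whiskerLeft_comp_assoc, IsMonHom.one_hom, MonObj.mul_one]
    simp

/-- This is `(b ⊗ 1)(1 ⊗ e) = b ⊗ e`. The only braiding that remains is with the unit object, so the
rest is coherence. -/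
lemma tensorHom_inclusions_mul : ((ρ_ B).inv ≫ B ◁ η[E] ⊗ₘ (λ_ E).inv ≫ η[B] ▷ E) ≫ μ[B ⊗ E] =
    𝟙 (B ⊗ E) := by
  change _ ≫ tensorμ B E B E ≫ (μ[B] ⊗ₘ μ[E]) = _
  rw [← tensorHom_comp_tensorHom_assoc, ← id_tensorHom, ← tensorHom_id, tensorμ_natural_assoc,
    tensorHom_comp_tensorHom, id_tensorHom, tensorHom_id, MonObj.one_mul, MonObj.mul_one]
  simp only [tensorμ, braiding_tensorUnit_left]
  monoidal

end Pushout

lemma isMonHom_pushoutLeft {A B E : C} [MonObj A] [MonObj B] [MonObj E] [IsCommMonObj E]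
    (β : A ⟶ E) [IsMonHom β] : IsMonHom (pushoutLeft (B := B) β) :=
  have := isMonHom_mul E
  inferInstance

lemma isMonHom_pushoutRight {A B E : C} [MonObj A] [MonObj B] [MonObj E] [IsCommMonObj B]
    (α : A ⟶ B) [IsMonHom α] : IsMonHom (pushoutRight (E := E) α) :=
  have := isMonHom_mul B
  inferInstance

section Pushout

variable {A B E : C} [MonObj A] [MonObj B] [MonObj E] [IsCommMonObj B] [IsCommMonObj E]
  (α : A ⟶ B) (β : A ⟶ E) [IsMonHom α] [IsMonHom β]

/-- The underlying object of the pushout `B ⊗_A E` of commutative monoids. -/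
def pushoutObj : C := coequalizer (pushoutLeft (B := B) β) (pushoutRight (E := E) α)

/-- The projection `B ⊗ E ⟶ B ⊗_A E`. -/
def pushoutπ : B ⊗ E ⟶ pushoutObj α β := coequalizer.π _ _

instance : Epi (pushoutπ α β) := inferInstanceAs (Epi (coequalizer.π _ _))

lemma pushoutπ_condition :
    pushoutLeft (B := B) β ≫ pushoutπ α β = pushoutRight (E := E) α ≫ pushoutπ α β :=
  coequalizer.condition _ _

instance pushoutMonObj : MonObj (pushoutObj α β) :=
  have := isMonHom_pushoutLeft (B := B) β
  have := isMonHom_pushoutRight (E := E) α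
  coequalizerMonObj _ _ (pushout_reflexive α β)

instance pushoutIsCommMonObj : IsCommMonObj (pushoutObj α β) :=
  have := isMonHom_pushoutLeft (B := B) β
  have := isMonHom_pushoutRight (E := E) α
  isCommMonObj_coequalizer _ _ (pushout_reflexive α β)

instance isMonHom_pushoutπ : IsMonHom (pushoutπ α β) :=
  have := isMonHom_pushoutLeft (B := B) β
  have := isMonHom_pushoutRight (E := E) α
  isMonHom_coequalizerπ _ _ (pushout_reflexive α β)

lemma isMonHom_of_pushoutπ_comp {X : C} [MonObj X] (k : pushoutObj α β ⟶ X)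
    (hk : IsMonHom (pushoutπ α β ≫ k)) : IsMonHom k :=
  have : IsMonHom (coequalizer.π (pushoutLeft (B := B) β) (pushoutRight (E := E) α) ≫ k) := hk
  have := isMonHom_pushoutLeft (B := B) β
  have := isMonHom_pushoutRight (E := E) α
  isMonHom_of_coequalizerπ_comp _ _ (pushout_reflexive α β) k

/-- The inclusion `B ⟶ B ⊗_A E`. -/
def pushoutInl : B ⟶ pushoutObj α β := ((ρ_ B).inv ≫ B ◁ η[E]) ≫ pushoutπ α β

/-- The inclusion `E ⟶ B ⊗_A E`. -/
def pushoutInr : E ⟶ pushoutObj α β := ((λ_ E).inv ≫ η[B] ▷ E) ≫ pushoutπ α β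

instance isMonHom_pushoutInl : IsMonHom (pushoutInl α β) :=
  haveI := isMonHom_one E
  inferInstanceAs (IsMonHom (((ρ_ B).inv ≫ B ◁ η[E]) ≫ pushoutπ α β))

instance isMonHom_pushoutInr : IsMonHom (pushoutInr α β) :=
  haveI := isMonHom_one B
  inferInstanceAs (IsMonHom (((λ_ E).inv ≫ η[B] ▷ E) ≫ pushoutπ α β))

/-- The class of `b ⊗ e` is the product of the images of `b` and `e`; hence a monoid morphism out of
the pushout is determined on the two inclusions. -/
lemma tensorHom_pushout_mul :
    (pushoutInl α β ⊗ₘ pushoutInr α β) ≫ μ[pushoutObj α β] = pushoutπ α β := by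
  rw [pushoutInl, pushoutInr, ← tensorHom_comp_tensorHom, Category.assoc, ← IsMonHom.mul_hom,
    reassoc_of% (tensorHom_inclusions_mul (B := B) (E := E))]

/-- The coequalizer relation evaluated at `1 ⊗ a ⊗ 1`. -/
lemma pushout_w : α ≫ pushoutInl α β = β ≫ pushoutInr α β := by
  have h := ((λ_ A).inv ≫ η[B] ▷ A ≫ B ◁ (ρ_ A).inv ≫ B ◁ A ◁ η[E]) ≫= pushoutπ_condition α β
  have h1 : ((λ_ A).inv ≫ η[B] ▷ A ≫ B ◁ (ρ_ A).inv ≫ B ◁ A ◁ η[E]) ≫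
      pushoutLeft (B := B) β = β ≫ (λ_ E).inv ≫ η[B] ▷ E := by
    have : (ρ_ A).inv ≫ A ◁ η[E] ≫ β ▷ E ≫ μ[E] = β := by
      rw [whisker_exchange_assoc, MonObj.mul_one, rightUnitor_naturality, Iso.inv_hom_id_assoc]
    simp only [Category.assoc, pushoutLeft, ← MonoidalCategory.whiskerLeft_comp, this]
    rw [← whisker_exchange, leftUnitor_inv_naturality_assoc]
  have h2 : ((λ_ A).inv ≫ η[B] ▷ A ≫ B ◁ (ρ_ A).inv ≫ B ◁ A ◁ η[E]) ≫
      pushoutRight (E := E) α = α ≫ (ρ_ B).inv ≫ B ◁ η[E] := by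
    have : (λ_ A).inv ≫ η[B] ▷ A ≫ B ◁ α ≫ μ[B] = α := by
      rw [← whisker_exchange_assoc, MonObj.one_mul, leftUnitor_naturality, Iso.inv_hom_id_assoc]
    rw [pushoutRight]
    simp only [Category.assoc]
    rw [associator_inv_naturality_right_assoc, whisker_exchange]
    have h3 : B ◁ (ρ_ A).inv ≫ (α_ B A (𝟙_ C)).inv = (ρ_ (B ⊗ A)).inv := by simp
    rw [reassoc_of% h3, ← rightUnitor_inv_naturality_assoc]
    simp only [← Category.assoc] at this ⊢
    rw [this]
  have h' := (congrArg (· ≫ pushoutπ α β) h1).symm.trans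
    ((Category.assoc _ _ _).trans (h.trans ((Category.assoc _ _ _).symm.trans
      (congrArg (· ≫ pushoutπ α β) h2))))
  simpa only [Category.assoc, pushoutInl, pushoutInr] using h'.symm

variable {α β} in
lemma pushoutObj_hom_ext {X : C} [MonObj X] {k k' : pushoutObj α β ⟶ X} [IsMonHom k] [IsMonHom k']
    (h1 : pushoutInl α β ≫ k = pushoutInl α β ≫ k')
    (h2 : pushoutInr α β ≫ k = pushoutInr α β ≫ k') : k = k' := by
  rw [← cancel_epi (pushoutπ α β), ← tensorHom_pushout_mul, Category.assoc, Category.assoc,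
    IsMonHom.mul_hom, IsMonHom.mul_hom, tensorHom_comp_tensorHom_assoc,
    tensorHom_comp_tensorHom_assoc, h1, h2]

variable {X : C} [MonObj X] (u : B ⟶ X) (v : E ⟶ X) [IsMonHom u] [IsMonHom v]

/-- Both sides send `b ⊗ a ⊗ e` to the product of `u(b)`, the common image of `a`, and `v(e)`,
bracketed in the two possible ways. -/
lemma pushout_desc_condition (huv : α ≫ u = β ≫ v) :
    pushoutLeft (B := B) β ≫ (u ⊗ₘ v) ≫ μ[X] = pushoutRight (E := E) α ≫ (u ⊗ₘ v) ≫ μ[X] := by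
  have h1 : (β ▷ E ≫ μ[E]) ≫ v = (α ≫ u ⊗ₘ v) ≫ μ[X] := by
    rw [Category.assoc, IsMonHom.mul_hom, whiskerRight_comp_tensorHom_assoc, huv]
  have h2 : (B ◁ α ≫ μ[B]) ≫ u = (u ⊗ₘ α ≫ u) ≫ μ[X] := by
    rw [Category.assoc, IsMonHom.mul_hom, whiskerLeft_comp_tensorHom_assoc]
  have h3 : (u ⊗ₘ ((α ≫ u) ⊗ₘ v) ≫ μ[X]) = (u ⊗ₘ ((α ≫ u) ⊗ₘ v)) ≫ X ◁ μ[X] :=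
    (tensorHom_comp_whiskerLeft _ _ _).symm
  have h4 : ((u ⊗ₘ (α ≫ u)) ≫ μ[X] ⊗ₘ v) = ((u ⊗ₘ (α ≫ u)) ⊗ₘ v) ≫ μ[X] ▷ X :=
    (tensorHom_comp_whiskerRight _ _ _).symm
  rw [pushoutLeft, pushoutRight, whiskerLeft_comp_tensorHom_assoc, h1, Category.assoc,
    whiskerRight_comp_tensorHom_assoc, h2, h3, h4, Category.assoc, Category.assoc,
    MonObj.mul_assoc, associator_naturality_assoc, Iso.inv_hom_id_assoc]

/-- The morphism out of the pushout of commutative monoids. -/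
def pushoutDesc (huv : α ≫ u = β ≫ v) : pushoutObj α β ⟶ X :=
  coequalizer.desc ((u ⊗ₘ v) ≫ μ[X]) (pushout_desc_condition α β u v huv)

lemma pushoutπ_desc (huv : α ≫ u = β ≫ v) :
    pushoutπ α β ≫ pushoutDesc α β u v huv = (u ⊗ₘ v) ≫ μ[X] :=
  coequalizer.π_desc _ _

lemma isMonHom_pushoutDesc [IsCommMonObj X] (huv : α ≫ u = β ≫ v) :
    IsMonHom (pushoutDesc α β u v huv) :=
  isMonHom_of_pushoutπ_comp α β _ (by
    have := isMonHom_mul X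
    rw [pushoutπ_desc]
    infer_instance)

lemma pushoutInl_desc (huv : α ≫ u = β ≫ v) :
    pushoutInl α β ≫ pushoutDesc α β u v huv = u := by
  rw [pushoutInl, Category.assoc, pushoutπ_desc, Category.assoc, whiskerLeft_comp_tensorHom_assoc,
    IsMonHom.one_hom, MonObj.mul_one_hom, Iso.inv_hom_id_assoc]

lemma pushoutInr_desc (huv : α ≫ u = β ≫ v) :
    pushoutInr α β ≫ pushoutDesc α β u v huv = v := by
  rw [pushoutInr, Category.assoc, pushoutπ_desc, Category.assoc, whiskerRight_comp_tensorHom_assoc,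
    IsMonHom.one_hom, MonObj.one_mul_hom, Iso.inv_hom_id_assoc]

end Pushout

section Bundled

variable {a b e : CommMon C} (α : a ⟶ b) (β : a ⟶ e)

/-- The morphism of underlying objects of a morphism of commutative monoids. -/
def underlying {c d : CommMon C} (f : c ⟶ d) : c.X ⟶ d.X := f.hom.hom

instance {c d : CommMon C} (f : c ⟶ d) : IsMonHom (underlying f) := f.hom.isMonHom_hom

/-- A morphism of commutative monoids from a morphism of monoids. -/
abbrev commMonHom {c d : CommMon C} (f : c.X ⟶ d.X) (hf : IsMonHom f) : c ⟶ d :=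
  CommMon.homMk (A := c) (B := d) (@Mon.Hom.mk _ _ _ c.toMon d.toMon f hf)

/-- The pushout of commutative monoids. -/
def pushoutMon : CommMon C :=
  ⟨pushoutObj (A := a.X) (B := b.X) (E := e.X) (underlying α) (underlying β)⟩

/-- The first inclusion in the pushout of commutative monoids. -/
def pushoutMonInl : b ⟶ pushoutMon α β :=
  commMonHom (d := pushoutMon α β)
    (pushoutInl (A := a.X) (B := b.X) (E := e.X) (underlying α) (underlying β))
    (isMonHom_pushoutInl (A := a.X) (B := b.X) (E := e.X) (underlying α) (underlying β))

/-- The second inclusion in the pushout of commutative monoids. -/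
def pushoutMonInr : e ⟶ pushoutMon α β :=
  commMonHom (d := pushoutMon α β)
    (pushoutInr (A := a.X) (B := b.X) (E := e.X) (underlying α) (underlying β))
    (isMonHom_pushoutInr (A := a.X) (B := b.X) (E := e.X) (underlying α) (underlying β))

/-- The square defining `b ⊗_a e` is a pushout of commutative monoids. -/
theorem isPushout_pushoutMon : IsPushout α β (pushoutMonInl α β) (pushoutMonInr α β) where
  w := CommMon.hom_ext _ _
    (pushout_w (A := a.X) (B := b.X) (E := e.X) (underlying α) (underlying β))
  isColimit' := ⟨PushoutCocone.IsColimit.mk _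
    (fun s => commMonHom (c := pushoutMon α β) (pushoutDesc (A := a.X) (B := b.X) (E := e.X)
      (X := s.pt.X) (underlying α) (underlying β) (underlying s.inl) (underlying s.inr)
        (congrArg underlying s.condition)) (isMonHom_pushoutDesc _ _ _ _ _))
    (fun s => CommMon.hom_ext _ _ (pushoutInl_desc (A := a.X) (B := b.X) (E := e.X)
      (X := s.pt.X) (underlying α) (underlying β) (underlying s.inl) (underlying s.inr)
        (congrArg underlying s.condition)))
    (fun s => CommMon.hom_ext _ _ (pushoutInr_desc (A := a.X) (B := b.X) (E := e.X)
      (X := s.pt.X) (underlying α) (underlying β) (underlying s.inl) (underlying s.inr)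
        (congrArg underlying s.condition)))
    (fun s m h1 h2 => CommMon.hom_ext _ _ (by
      have : IsMonHom (M := pushoutObj (A := a.X) (B := b.X) (E := e.X)
        (underlying α) (underlying β))
        (N := s.pt.X) (underlying m) := m.hom.isMonHom_hom
      have h := isMonHom_pushoutDesc (A := a.X) (B := b.X) (E := e.X)
        (X := s.pt.X) (underlying α) (underlying β) (underlying s.inl) (underlying s.inr)
          (congrArg underlying s.condition)
      refine pushoutObj_hom_ext (A := a.X) (B := b.X) (E := e.X) (X := s.pt.X)
        (α := underlying α) (β := underlying β) (k := underlying m)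
        (k' := pushoutDesc (A := a.X) (B := b.X) (E := e.X) (X := s.pt.X) (underlying α)
          (underlying β) (underlying s.inl) (underlying s.inr) (congrArg underlying s.condition))
        ?_ ?_
      · exact (congrArg underlying h1).trans (pushoutInl_desc (A := a.X) (B := b.X)
          (E := e.X) (X := s.pt.X) (underlying α) (underlying β)
          (underlying s.inl) (underlying s.inr) _).symm
      · exact (congrArg underlying h2).trans (pushoutInr_desc (A := a.X) (B := b.X)
          (E := e.X) (X := s.pt.X) (underlying α) (underlying β)
          (underlying s.inl) (underlying s.inr) _).symm))⟩

end Bundled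

end CommMonPushout

/-! ### Base change for modules and stability of flatness -/

section BeckChevalley

open MonObj
open scoped MonoidalLeftAction

section

variable {C : Type u} [Category.{v} C] [MonoidalCategory C]
  {M : Type u'} [Category.{v'} M] [MonoidalLeftAction C M]

/-- Sliding the scalars of the module `n` across `B ⊙ (E ⊙ n) ⟶ P ⊙_E n`. -/
lemma act_smul_relProdπ [HasCoequalizers M] {B E P : C} [MonObj E] [MonObj P] (u : B ⟶ P)
    (w : E ⟶ P) (n : M) [ModObj E n] :
    B ⊴ₗ (ModObj.smul : E ⊙ₗ n ⟶ n) ≫ u ⊵ₗ n ≫ relProdπ w n =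
      (αₗ B E n).inv ≫ ((u ⊗ₘ w) ≫ μ[P]) ⊵ₗ n ≫ relProdπ w n := by
  have h1 : u ⊵ₗ (E ⊙ₗ n) ≫ (αₗ P E n).inv = (αₗ B E n).inv ≫ (u ▷ E) ⊵ₗ n := by
    rw [MonoidalLeftAction.whiskerRight_actionHomLeft, Iso.inv_hom_id_assoc]
  rw [MonoidalLeftAction.action_exchange_assoc, coequalizer.condition, Category.assoc,
    reassoc_of% h1, ← MonoidalLeftAction.comp_actionHomLeft_assoc,
    MonoidalCategory.tensorHom_def, Category.assoc]

lemma restrict_mul_smul {A E : C} [MonObj E] (β : A ⟶ E) (n : M) [ModObj E n] :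
    (β ▷ E ≫ μ[E]) ⊵ₗ n ≫ (ModObj.smul : E ⊙ₗ n ⟶ n) =
      (αₗ A E n).hom ≫ A ⊴ₗ (ModObj.smul : E ⊙ₗ n ⟶ n) ≫ β ⊵ₗ n ≫
        (ModObj.smul : E ⊙ₗ n ⟶ n) := by
  rw [MonoidalLeftAction.comp_actionHomLeft, Category.assoc, ModObj.mul_smul,
    MonoidalLeftAction.whiskerRight_actionHomLeft, Category.assoc, Category.assoc,
    Iso.inv_hom_id_assoc, MonoidalLeftAction.action_exchange_assoc]

end

variable {C : Type u} [Category.{v} C] [MonoidalCategory C] [SymmetricCategory C]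
  [MonoidalClosed C] [HasCoequalizers C]
  {M : Type u'} [Category.{v'} M] [MonoidalLeftAction C M] [HasCoequalizers M]
  {A B E : C} [MonObj A] [MonObj B] [MonObj E] [IsCommMonObj B] [IsCommMonObj E]
  (α : A ⟶ B) (β : A ⟶ E) [IsMonHom α] [IsMonHom β]

/-- The base change morphism `B ⊙_A n ⟶ (B ⊗_A E) ⊙_E n`. -/
def baseChange (n : M) [ModObj A n] [ModObj E n]
    (hn : (ModObj.smul : A ⊙ₗ n ⟶ n) = β ⊵ₗ n ≫ (ModObj.smul : E ⊙ₗ n ⟶ n)) :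
    relProd α n ⟶ relProd (pushoutInr α β) n :=
  coequalizer.desc (pushoutInl α β ⊵ₗ n ≫ relProdπ (pushoutInr α β) n) (by
    have h1 : (B ◁ α ≫ μ[B]) ≫ pushoutInl α β =
        B ◁ β ≫ (pushoutInl α β ⊗ₘ pushoutInr α β) ≫ μ[pushoutObj α β] := by
      rw [Category.assoc, IsMonHom.mul_hom, whiskerLeft_comp_tensorHom_assoc,
        whiskerLeft_comp_tensorHom_assoc, pushout_w]
    have h2 : (αₗ B A n).inv ≫ (B ◁ β) ⊵ₗ n = B ⊴ₗ β ⊵ₗ n ≫ (αₗ B E n).inv := by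
      rw [MonoidalLeftAction.whiskerLeft_actionHomLeft, Iso.inv_hom_id_assoc]
    rw [leftArrow, hn, MonoidalLeftAction.actionHomRight_comp, Category.assoc, act_smul_relProdπ,
      rightArrow, Category.assoc, ← MonoidalLeftAction.comp_actionHomLeft_assoc, h1,
      MonoidalLeftAction.comp_actionHomLeft_assoc (B ◁ β), reassoc_of% h2])

lemma relProdπ_baseChange (n : M) [ModObj A n] [ModObj E n]
    (hn : (ModObj.smul : A ⊙ₗ n ⟶ n) = β ⊵ₗ n ≫ (ModObj.smul : E ⊙ₗ n ⟶ n)) :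
    relProdπ α n ≫ baseChange α β n hn = pushoutInl α β ⊵ₗ n ≫ relProdπ (pushoutInr α β) n :=
  coequalizer.π_desc _ _

/-- The assignment `b ⊗ e ⊗ x ↦ b ⊗ ex` respects the relation defining `B ⊗_A E`: it sends `b ⊗
β(a)e ⊗ x` to `b ⊗ a(ex)` and `bα(a) ⊗ e ⊗ x` to `bα(a) ⊗ ex`, which agree in `B ⊙_A n`. -/
lemma pushoutLeft_act_smul (n : M) [ModObj A n] [ModObj E n]
    (hn : (ModObj.smul : A ⊙ₗ n ⟶ n) = β ⊵ₗ n ≫ (ModObj.smul : E ⊙ₗ n ⟶ n)) :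
    pushoutLeft (B := B) β ⊵ₗ n ≫ (αₗ B E n).hom ≫ B ⊴ₗ (ModObj.smul : E ⊙ₗ n ⟶ n) ≫
        relProdπ α n =
      pushoutRight (E := E) α ⊵ₗ n ≫ (αₗ B E n).hom ≫ B ⊴ₗ (ModObj.smul : E ⊙ₗ n ⟶ n) ≫
        relProdπ α n := by
  rw [pushoutLeft, MonoidalLeftAction.whiskerLeft_actionHomLeft, Category.assoc, Category.assoc,
    Iso.inv_hom_id_assoc, ← MonoidalLeftAction.actionHomRight_comp_assoc, restrict_mul_smul, ← hn,
    MonoidalLeftAction.actionHomRight_comp, MonoidalLeftAction.actionHomRight_comp,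
    Category.assoc, Category.assoc, coequalizer.condition, pushoutRight,
    MonoidalLeftAction.comp_actionHomLeft, Category.assoc,
    MonoidalLeftAction.whiskerRight_actionHomLeft, Category.assoc, Category.assoc, Category.assoc,
    Iso.inv_hom_id_assoc, ← MonoidalLeftAction.action_exchange_assoc,
    MonoidalLeftAction.tensor_actionHomRight, Category.assoc, Category.assoc]
  have h := (α_ B A E).inv ⊵ₗ n ≫= MonoidalLeftAction.associator_actionHom B A E n
  rw [← MonoidalLeftAction.comp_actionHomLeft_assoc, Iso.inv_hom_id,
    MonoidalLeftAction.id_actionHomLeft, Category.id_comp] at h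
  rw [reassoc_of% h]

variable [∀ m : M, PreservesColimitsOfShape WalkingParallelPair
  (MonoidalLeftAction.actionRight C m)]

/-- `- ⊙ n` preserves the coequalizer defining `B ⊗_A E`. -/
def isColimitPushoutAct (n : M) : IsColimit (Cofork.ofπ (pushoutπ α β ⊵ₗ n)
    (by rw [← MonoidalLeftAction.comp_actionHomLeft, pushoutπ_condition,
      MonoidalLeftAction.comp_actionHomLeft]) :
      Cofork (pushoutLeft (B := B) β ⊵ₗ n) (pushoutRight (E := E) α ⊵ₗ n)) :=
  isColimitOfHasCoequalizerOfPreservesColimit (MonoidalLeftAction.actionRight C n)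
    (pushoutLeft (B := B) β) (pushoutRight (E := E) α)

instance epi_pushoutπ_act (n : M) : Epi (pushoutπ α β ⊵ₗ n) :=
  Cofork.IsColimit.epi (isColimitPushoutAct α β n)

/-- The morphism `(B ⊗_A E) ⊙ n ⟶ B ⊙_A n`. -/
def pushoutAct (n : M) [ModObj A n] [ModObj E n]
    (hn : (ModObj.smul : A ⊙ₗ n ⟶ n) = β ⊵ₗ n ≫ (ModObj.smul : E ⊙ₗ n ⟶ n)) :
    pushoutObj α β ⊙ₗ n ⟶ relProd α n :=
  Cofork.IsColimit.desc (isColimitPushoutAct α β n) _ (pushoutLeft_act_smul α β n hn)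

lemma pushoutπ_pushoutAct (n : M) [ModObj A n] [ModObj E n]
    (hn : (ModObj.smul : A ⊙ₗ n ⟶ n) = β ⊵ₗ n ≫ (ModObj.smul : E ⊙ₗ n ⟶ n)) :
    pushoutπ α β ⊵ₗ n ≫ pushoutAct α β n hn =
      (αₗ B E n).hom ≫ B ⊴ₗ (ModObj.smul : E ⊙ₗ n ⟶ n) ≫ relProdπ α n :=
  Cofork.IsColimit.π_desc' (isColimitPushoutAct α β n) _ _

/-- In elements, `(b ⊗ e) · (1 ⊗ e') = b ⊗ ee'`. It is used to see that the inverse of base change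
respects the relations over `E`. -/
lemma pushoutπ_mul_inr : pushoutπ α β ▷ E ≫ pushoutObj α β ◁ pushoutInr α β ≫
    μ[pushoutObj α β] = (α_ B E E).hom ≫ B ◁ μ[E] ≫ pushoutπ α β := by
  have h1 : pushoutπ α β ▷ E ≫ pushoutObj α β ◁ pushoutInr α β =
      ((pushoutInl α β ⊗ₘ pushoutInr α β) ⊗ₘ pushoutInr α β) ≫ μ[pushoutObj α β] ▷ _ := by
    rw [← MonoidalCategory.tensorHom_def, tensorHom_comp_whiskerRight, tensorHom_pushout_mul]
  rw [reassoc_of% h1, MonObj.mul_assoc, associator_naturality_assoc,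
    tensorHom_comp_whiskerLeft_assoc, ← IsMonHom.mul_hom, ← tensorHom_pushout_mul,
    whiskerLeft_comp_tensorHom_assoc]

/-- The inverse of the base change morphism. -/
def baseChangeInv (n : M) [ModObj A n] [ModObj E n]
    (hn : (ModObj.smul : A ⊙ₗ n ⟶ n) = β ⊵ₗ n ≫ (ModObj.smul : E ⊙ₗ n ⟶ n)) :
    relProd (pushoutInr α β) n ⟶ relProd α n :=
  coequalizer.desc (pushoutAct α β n hn) (by
    have h1 : pushoutπ α β ⊵ₗ (E ⊙ₗ n) ≫ (αₗ (pushoutObj α β) E n).inv =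
        (αₗ (B ⊗ E) E n).inv ≫ (pushoutπ α β ▷ E) ⊵ₗ n := by
      rw [MonoidalLeftAction.whiskerRight_actionHomLeft, Iso.inv_hom_id_assoc]
    rw [← cancel_epi (pushoutπ α β ⊵ₗ (E ⊙ₗ n)), leftArrow, rightArrow,
      ← MonoidalLeftAction.action_exchange_assoc, pushoutπ_pushoutAct, Category.assoc,
      reassoc_of% h1, ← MonoidalLeftAction.comp_actionHomLeft_assoc, pushoutπ_mul_inr,
      MonoidalLeftAction.comp_actionHomLeft, MonoidalLeftAction.comp_actionHomLeft,
      Category.assoc, Category.assoc, pushoutπ_pushoutAct,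
      MonoidalLeftAction.whiskerLeft_actionHomLeft, Category.assoc, Category.assoc,
      Iso.inv_hom_id_assoc, ← MonoidalLeftAction.actionHomRight_comp_assoc, ModObj.mul_smul,
      MonoidalLeftAction.actionHomRight_comp, Category.assoc,
      MonoidalLeftAction.associator_actionHom_assoc, Iso.inv_hom_id_assoc,
      MonoidalLeftAction.tensor_actionHomRight, Category.assoc, Category.assoc,
      Iso.inv_hom_id_assoc]
    simp only [MonoidalLeftAction.actionHomRight_comp, Category.assoc])

lemma relProdπ_baseChangeInv (n : M) [ModObj A n] [ModObj E n]
    (hn : (ModObj.smul : A ⊙ₗ n ⟶ n) = β ⊵ₗ n ≫ (ModObj.smul : E ⊙ₗ n ⟶ n)) :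
    relProdπ (pushoutInr α β) n ≫ baseChangeInv α β n hn = pushoutAct α β n hn :=
  coequalizer.π_desc _ _

/-- Base change for modules: `B ⊙_A n ≅ (B ⊗_A E) ⊙_E n`. -/
def baseChangeIso (n : M) [ModObj A n] [ModObj E n]
    (hn : (ModObj.smul : A ⊙ₗ n ⟶ n) = β ⊵ₗ n ≫ (ModObj.smul : E ⊙ₗ n ⟶ n)) :
    relProd α n ≅ relProd (pushoutInr α β) n where
  hom := baseChange α β n hn
  inv := baseChangeInv α β n hn
  hom_inv_id := by
    apply coequalizer.hom_ext
    have h := relProdπ_baseChange α β n hn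
    rw [reassoc_of% h, relProdπ_baseChangeInv, Category.comp_id, pushoutInl,
      MonoidalLeftAction.comp_actionHomLeft, Category.assoc, pushoutπ_pushoutAct,
      MonoidalLeftAction.comp_actionHomLeft, MonoidalLeftAction.whiskerLeft_actionHomLeft]
    simp only [Category.assoc, Iso.inv_hom_id_assoc]
    rw [← MonoidalLeftAction.actionHomRight_comp_assoc, ModObj.one_smul,
      ← MonoidalLeftAction.rightUnitor_actionHom_assoc,
      ← MonoidalLeftAction.comp_actionHomLeft_assoc, Iso.inv_hom_id,
      MonoidalLeftAction.id_actionHomLeft, Category.id_comp]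
  inv_hom_id := by
    apply coequalizer.hom_ext
    rw [← cancel_epi (pushoutπ α β ⊵ₗ n)]
    have h := relProdπ_baseChangeInv α β n hn
    have h' := pushoutπ_pushoutAct α β n hn
    rw [reassoc_of% h, reassoc_of% h', relProdπ_baseChange, act_smul_relProdπ,
      Iso.hom_inv_id_assoc, tensorHom_pushout_mul, Category.comp_id]

variable [∀ c : C, PreservesColimitsOfShape WalkingParallelPair (MonoidalLeftAction.actionLeft M c)]

lemma baseChange_naturality {n n' : M} [ModObj A n] [ModObj E n] [ModObj A n'] [ModObj E n']
    (hn : (ModObj.smul : A ⊙ₗ n ⟶ n) = β ⊵ₗ n ≫ (ModObj.smul : E ⊙ₗ n ⟶ n))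
    (hn' : (ModObj.smul : A ⊙ₗ n' ⟶ n') = β ⊵ₗ n' ≫ (ModObj.smul : E ⊙ₗ n' ⟶ n'))
    (φ : n ⟶ n') (f : relProd α n ⟶ relProd α n')
    (g : relProd (pushoutInr α β) n ⟶ relProd (pushoutInr α β) n')
    (hf : relProdπ α n ≫ f = B ⊴ₗ φ ≫ relProdπ α n')
    (hg : relProdπ (pushoutInr α β) n ≫ g = pushoutObj α β ⊴ₗ φ ≫ relProdπ (pushoutInr α β) n') :
    f ≫ baseChange α β n' hn' = baseChange α β n hn ≫ g := by
  apply coequalizer.hom_ext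
  have h := relProdπ_baseChange α β n hn
  rw [reassoc_of% hf, relProdπ_baseChange, reassoc_of% h, hg,
    MonoidalLeftAction.action_exchange_assoc]

variable (M) in
/-- Base change: `β_* ≫ α^*` agrees with extension of scalars along `E ⟶ B ⊗_A E` on underlying
objects. -/
def extendScalarsBaseChange : Mod.comap β ⋙ extendScalars M α ⋙ Mod.forget B ≅
    extendScalars M (pushoutInr α β) ⋙ Mod.forget (pushoutObj α β) :=
  NatIso.ofComponents (fun n =>
    letI : ModObj A n.X := Mod.scalarRestriction β n.X
    baseChangeIso α β n.X rfl) (fun {n n'} φ =>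
    letI : ModObj A n.X := Mod.scalarRestriction β n.X
    letI : ModObj A n'.X := Mod.scalarRestriction β n'.X
    baseChange_naturality α β (n := n.X) (n' := n'.X) rfl rfl φ.hom _ _
      (relProdπ_extendScalars_map α ((Mod.comap β).map φ))
      (relProdπ_extendScalars_map (pushoutInr α β) φ))

/-- Forgetting the action reflects limits, and after forgetting, extension along `E ⟶ B ⊗_A E`
becomes restriction to `A`, extension along `α`, then forgetting. The outer two are right adjoints
and the middle one preserves finite limits. -/
lemma preservesFiniteLimits_extendScalars_pushoutInr [PreservesFiniteLimits (extendScalars M α)] :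
    PreservesFiniteLimits (extendScalars M (pushoutInr α β)) := by
  have : PreservesFiniteLimits (extendScalars M (pushoutInr α β) ⋙
      Mod.forget (pushoutObj α β)) := by
    have : PreservesFiniteLimits (Mod.forget B : Mod M B ⥤ M) := inferInstance
    have : PreservesFiniteLimits (Mod.comap β : Mod M E ⥤ Mod M A) := inferInstance
    exact preservesFiniteLimits_of_natIso (extendScalarsBaseChange M α β)
  exact ⟨fun J _ _ => ⟨fun {K} => preservesLimit_of_reflects_of_preserves _
    (Mod.forget (pushoutObj α β))⟩⟩

lemma IsFlat.pushoutMonInr {a b e : CommMon C} {α : a ⟶ b} (h : IsFlat M α) (β : a ⟶ e) :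
    IsFlat M (pushoutMonInr α β) :=
  have : PreservesFiniteLimits (extendScalars M (A := a.X) (B := b.X) (underlying α)) := h
  preservesFiniteLimits_extendScalars_pushoutInr (A := a.X) (B := b.X) (E := e.X)
    (underlying α) (underlying β)

end BeckChevalley

/-! ### Epimorphisms of finite type -/

section FiniteType

universe w₁ w₂

variable {K : Type u} [Category.{v} K]

/-- This removes the uniqueness half of finite presentability: for an epimorphism only the existence
of a factorization through a stage matters. -/
lemma under_hom_subsingleton {a b : K} (α : a ⟶ b) [Epi α] (X : Under a) :
    Subsingleton (Under.mk α ⟶ X) where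
  allEq f g := by
    ext
    rw [← cancel_epi α]
    exact (Under.w f).trans (Under.w g).symm

/-- An epimorphism `α : a ⟶ b` is a finitely presented object of `a/K` if the morphisms from `α`
to a filtered colimit factor through a stage. -/
lemma preservesFilteredColimits_of_factors {a b : K} (α : a ⟶ b) [Epi α]
    (h : ∀ (J : Type w₁) [Category.{w₂} J] [IsFiltered J] (D : J ⥤ Under a) (c : Cocone D),
      IsColimit c → (Under.mk α ⟶ c.pt) → ∃ j, Nonempty (Under.mk α ⟶ D.obj j)) :
    PreservesFilteredColimitsOfSize.{w₂, w₁} (coyoneda.obj (op (Under.mk α))) where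
  preserves_filtered_colimits J _ _ := ⟨fun {D} => ⟨fun {c} hc => ⟨by
    have hs : ∀ X : Under a, Subsingleton ((coyoneda.obj (op (Under.mk α))).obj X) :=
      under_hom_subsingleton α
    refine Types.FilteredColimit.isColimitOf _ _ (fun x => ?_) (fun i j xi xj _ => ?_)
    · obtain ⟨j, ⟨y⟩⟩ := h J D c hc x
      exact ⟨j, y, (hs c.pt).elim _ _⟩
    · exact ⟨IsFiltered.max i j, IsFiltered.leftToMax i j, IsFiltered.rightToMax i j,
        (hs _).elim _ _⟩⟩⟩⟩

lemma exists_factor_of_preservesFilteredColimits {a b : K} (α : a ⟶ b)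
    (h : PreservesFilteredColimitsOfSize.{w₂, w₁} (coyoneda.obj (op (Under.mk α))))
    {J : Type w₁} [Category.{w₂} J] [IsFiltered J] {D : J ⥤ Under a} {c : Cocone D}
    (hc : IsColimit c) (f : Under.mk α ⟶ c.pt) : ∃ j, Nonempty (Under.mk α ⟶ D.obj j) := by
  have := h.preserves_filtered_colimits J
  obtain ⟨j, y, -⟩ := Types.jointly_surjective_of_isColimit
    (isColimitOfPreserves (coyoneda.obj (op (Under.mk α))) hc) f
  exact ⟨j, ⟨y⟩⟩

lemma finiteType_id (a : K) : PreservesFilteredColimitsOfSize.{w₂, w₁}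
    (coyoneda.obj (op (Under.mk (𝟙 a)))) :=
  preservesFilteredColimits_of_factors _ fun J _ _ D _ _ _ =>
    ⟨(IsFiltered.nonempty (C := J)).some, ⟨Under.homMk (D.obj _).hom (Category.id_comp _)⟩⟩

/-- A filtered diagram under `e` is one under `a` by restriction along `β`, with the same colimit
since connected colimits in coslices are computed in `K`. A factorization of `b` through a stage,
together with the structure map from `e`, induces one of the pushout. -/
lemma finiteType_pushout {a b e p : K} {α : a ⟶ b} {β : a ⟶ e} {i : b ⟶ p} {i' : e ⟶ p} [Epi α]
    (sq : IsPushout α β i i')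
    (h : PreservesFilteredColimitsOfSize.{w₂, w₁} (coyoneda.obj (op (Under.mk α)))) :
    PreservesFilteredColimitsOfSize.{w₂, w₁} (coyoneda.obj (op (Under.mk i'))) := by
  have : Epi i' := sq.epi_inr_of_epi
  refine preservesFilteredColimits_of_factors _ fun J _ _ D c hc f => ?_
  have := IsFiltered.isConnected J
  have hc' : IsColimit ((Under.map β).mapCocone c) :=
    isColimitOfReflects (Under.forget a) (isColimitOfPreserves (Under.forget e) hc)
  obtain ⟨j, ⟨g⟩⟩ := exists_factor_of_preservesFilteredColimits α h hc'
    (Under.homMk (i ≫ f.right) (by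
      have h1 : i' ≫ f.right = c.pt.hom := Under.w f
      change α ≫ i ≫ f.right = β ≫ c.pt.hom
      rw [sq.w_assoc, h1]))
  have hg : α ≫ g.right = β ≫ (D.obj j).hom := Under.w g
  exact ⟨j, ⟨Under.homMk (sq.desc g.right (D.obj j).hom hg) (sq.inr_desc _ _ _)⟩⟩

/-- Finite type of `α` first brings `b` to a stage `j`. The diagram beyond `j` then lives under `b`,
and finite type of `β` brings `e` to a later stage. -/
lemma finiteType_comp {a b e : K} {α : a ⟶ b} {β : b ⟶ e} [Epi α] [Epi β]
    (hα : PreservesFilteredColimitsOfSize.{w₁, w₁} (coyoneda.obj (op (Under.mk α))))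
    (hβ : PreservesFilteredColimitsOfSize.{w₁, w₁} (coyoneda.obj (op (Under.mk β)))) :
    PreservesFilteredColimitsOfSize.{w₁, w₁} (coyoneda.obj (op (Under.mk (α ≫ β)))) := by
  refine preservesFilteredColimits_of_factors _ fun J _ _ D c hc f => ?_
  have hf : (α ≫ β) ≫ f.right = c.pt.hom := Under.w f
  obtain ⟨j, ⟨g⟩⟩ := exists_factor_of_preservesFilteredColimits α hα hc
    (Under.homMk (β ≫ f.right) ((Category.assoc _ _ _).symm.trans hf))
  have hg : α ≫ g.right = (D.obj j).hom := Under.w g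
  -- The tail of `D` beyond `j`, with structure maps from `b` through `g`. It has the same colimit
  -- because `Under.forget j` is final for filtered `J`.
  let D' : Under j ⥤ Under b :=
    { obj := fun k => Under.mk (g.right ≫ (D.map k.hom).right)
      map := fun {k l} t => Under.homMk (D.map t.right).right (by
        have h1 : (D.map k.hom).right ≫ (D.map t.right).right = (D.map l.hom).right := by
          rw [← Under.comp_right, ← D.map_comp, Under.w t]
        exact (Category.assoc _ _ _).trans (congrArg (g.right ≫ ·) h1))
      map_id := fun k => by
        ext
        simp
      map_comp := fun s t => by
        ext
        simp }
  have hw (k : Under j) : (D.map k.hom).right ≫ (c.ι.app k.right).right = (c.ι.app j).right := by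
    rw [← Under.comp_right, c.w]
  let c' : Cocone D' :=
    { pt := Under.mk (g.right ≫ (c.ι.app j).right)
      ι :=
        { app := fun k => Under.homMk (c.ι.app k.right).right
            ((Category.assoc _ _ _).trans (congrArg (g.right ≫ ·) (hw k)))
          naturality := fun k l t => by
            ext
            have h1 : (D.map t.right).right ≫ (c.ι.app l.right).right =
                (c.ι.app k.right).right := by
              rw [← Under.comp_right, c.w]
            exact h1.trans (Category.comp_id _).symm } }
  have := IsFiltered.isConnected J
  have := IsFiltered.isConnected (Under j)
  have hc' : IsColimit c' := isColimitOfReflects (Under.forget b)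
    ((Functor.Final.isColimitWhiskerEquiv (Under.forget j) _).symm
      (isColimitOfPreserves (Under.forget a) hc))
  obtain ⟨k, ⟨t⟩⟩ := exists_factor_of_preservesFilteredColimits β hβ hc'
    (Under.homMk f.right (by
      change β ≫ f.right = g.right ≫ (c.ι.app j).right
      -- The choice of `g` records no compatibility with `f`; the two maps from `b` to the colimit
      -- agree because both restrict along the epimorphism `α` to the structure map.
      rw [← cancel_epi α, ← Category.assoc, hf, reassoc_of% hg]
      exact (Under.w (c.ι.app j)).symm))
  have ht : β ≫ t.right = g.right ≫ (D.map k.hom).right := Under.w t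
  refine ⟨k.right, ⟨Under.homMk t.right ?_⟩⟩
  change (α ≫ β) ≫ t.right = _
  rw [Category.assoc, ht, reassoc_of% hg, Under.w]

end FiniteType

/-! ### Stability of spectral immersions and refinement of covering sieves -/

section SpectralImmersion

variable {C : Type u} [Category.{v} C] [MonoidalCategory C] [SymmetricCategory C]
  {M : Type u'} [Category.{v'} M] [MonoidalLeftAction C M] [HasCoequalizers M]
  [∀ c : C, PreservesColimitsOfShape WalkingParallelPair (MonoidalLeftAction.actionLeft M c)]

variable (M) in
lemma IsSpectralImmersion.id (X : Aff C) : IsSpectralImmersion M (𝟙 X) where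
  flat := preservesFiniteLimits_of_natIso (extendScalarsId (M := M) (A := X.unop.X)).symm
  epi := inferInstanceAs (Epi (𝟙 X.unop))
  finiteType := finiteType_id X.unop

lemma IsSpectralImmersion.comp {X Y Z : Aff C} {f : X ⟶ Y} {g : Y ⟶ Z}
    (hf : IsSpectralImmersion M f) (hg : IsSpectralImmersion M g) :
    IsSpectralImmersion M (f ≫ g) where
  flat :=
    have : PreservesFiniteLimits (extendScalars M (underlying f.unop)) := hf.flat
    have : PreservesFiniteLimits (extendScalars M (underlying g.unop)) := hg.flat
    preservesFiniteLimits_of_natIso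
      (extendScalarsComp (M := M) (underlying g.unop) (underlying f.unop)).symm
  epi :=
    have := hf.epi
    have := hg.epi
    epi_comp g.unop f.unop
  finiteType :=
    have := hf.epi
    have := hg.epi
    finiteType_comp hg.finiteType hf.finiteType

variable [MonoidalClosed C] [HasCoequalizers C]
  [∀ m : M, PreservesColimitsOfShape WalkingParallelPair (MonoidalLeftAction.actionRight C m)]

/-- Spectral immersions are stable under base change. -/
lemma IsSpectralImmersion.exists_isPullback {X Y Z : Aff C} {f : Y ⟶ X}
    (hf : IsSpectralImmersion M f) (k : Z ⟶ X) :
    ∃ (W : Aff C) (k' : W ⟶ Y) (f' : W ⟶ Z), IsPullback k' f' f k ∧ IsSpectralImmersion M f' := by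
  have sq := isPushout_pushoutMon f.unop k.unop
  have := hf.epi
  exact ⟨op (pushoutMon f.unop k.unop), (pushoutMonInl f.unop k.unop).op,
    (pushoutMonInr f.unop k.unop).op, sq.op.flip,
    IsFlat.pushoutMonInr hf.flat k.unop, sq.epi_inr_of_epi, finiteType_pushout sq hf.finiteType⟩

variable (M) in
/-- The presieve of spectral immersions in a sieve. -/
def spectralPart {X : Aff C} (S : Sieve X) : Presieve X :=
  fun _ f => S f ∧ IsSpectralImmersion M f

variable (C M) in
/-- The sieves that are covering already by their spectral immersions. -/
def spectralCoverTopology : GrothendieckTopology (Aff C) where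
  sieves X := {S | Sieve.generate (spectralPart M S) ∈ spectralTopology C M X}
  top_mem' X := by
    have h : Sieve.generate (spectralPart M (⊤ : Sieve X)) = ⊤ := by
      rw [← Sieve.id_mem_iff_eq_top]
      exact Sieve.le_generate _ _ _ (show spectralPart M ⊤ (𝟙 X) from
        ⟨trivial, IsSpectralImmersion.id M X⟩)
    change _ ∈ spectralTopology C M X
    rw [h]
    exact (spectralTopology C M).top_mem X
  -- A map that factors through a spectral member of `S` after composition with `k` factors through
  -- the base change of that member, which is a spectral member of the pulled back sieve.
  pullback_stable' X Z S k hS := by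
    refine (spectralTopology C M).superset_covering ?_
      ((spectralTopology C M).pullback_stable k hS)
    rintro W g ⟨Y, h, f, ⟨hf, hf'⟩, hw⟩
    obtain ⟨W', k', f', sq, h'⟩ := hf'.exists_isPullback k
    refine ⟨W', sq.lift h g hw, f', ⟨?_, h'⟩, sq.lift_snd _ _ _⟩
    change S (f' ≫ k)
    rw [← sq.w]
    exact S.downward_closed hf k'
  -- A spectral member of `R.pullback f`, composed with a spectral `f` in `S`, is a spectral member
  -- of `R`.
  transitive' X S hS R hR := by
    refine (spectralTopology C M).transitive hS _ ?_
    rintro Y _ ⟨Z, h, f, ⟨hf, hf'⟩, rfl⟩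
    refine (spectralTopology C M).superset_covering ?_
      ((spectralTopology C M).pullback_stable h (hR hf))
    rintro W g ⟨V, l, t, ⟨ht, ht'⟩, hw⟩
    refine ⟨V, l, t ≫ f, ⟨ht, ht'.comp hf'⟩, ?_⟩
    rw [← Category.assoc, hw, Category.assoc]

/-- The spectral immersions in a covering sieve generate a covering sieve. -/
lemma generate_spectralPart_mem {X : Aff C} {S : Sieve X} (hS : S ∈ spectralTopology C M X) :
    Sieve.generate (spectralPart M S) ∈ spectralTopology C M X := by
  have h : spectralTopology C M ≤ spectralCoverTopology C M := by
    refine Precoverage.toGrothendieck_le_iff_le_toPrecoverage.mpr ?_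
    rintro X _ ⟨I, Y, f, hf, rfl⟩
    rw [GrothendieckTopology.mem_toPrecoverage_iff]
    refine (spectralTopology C M).superset_covering ?_
      (Precoverage.generate_mem_toGrothendieck (J := spectralPrecoverage C M)
        ⟨I, Y, f, hf, rfl⟩)
    refine Sieve.generate_mono ?_
    rintro _ _ ⟨i⟩
    exact ⟨Sieve.le_generate _ _ _ (Presieve.ofArrows.mk i), hf.immersion i⟩
  exact h X hS

end SpectralImmersion

/-! ### Kernel pairs of maps out of coproducts -/

section KernelPairs

variable {D : Type*} [Category* D] [HasFiniteProducts D] [HasPullbacks D]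

/-- A kernel pair is an equivalence relation. -/
lemma isEquivalenceRelation_of_isPullback {R H F : D} {r : R ⟶ H ⨯ H} {π : H ⟶ F}
    (sq : IsPullback (r ≫ prod.fst) (r ≫ prod.snd) π π) : IsEquivalenceRelation r where
  mono := ⟨fun g h hgh => sq.hom_ext (by rw [reassoc_of% hgh]) (by rw [reassoc_of% hgh])⟩
  refl := ⟨sq.lift (𝟙 H) (𝟙 H) rfl, by
    ext1
    · rw [Category.assoc, sq.lift_fst, prod.lift_fst]
    · rw [Category.assoc, sq.lift_snd, prod.lift_snd]⟩
  symm := ⟨sq.lift (r ≫ prod.snd) (r ≫ prod.fst) sq.w.symm, by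
    ext1
    · rw [Category.assoc, sq.lift_fst, Category.assoc, prod.lift_fst]
    · rw [Category.assoc, sq.lift_snd, Category.assoc, prod.lift_snd]⟩
  trans := by
    have hw : (pullback.fst (r ≫ prod.snd) (r ≫ prod.fst) ≫ r ≫ prod.fst) ≫ π =
        (pullback.snd (r ≫ prod.snd) (r ≫ prod.fst) ≫ r ≫ prod.snd) ≫ π := by
      rw [Category.assoc, Category.assoc, ← Category.assoc r, sq.w, ← Category.assoc,
        ← Category.assoc,
        Category.assoc _ r, pullback.condition, Category.assoc, sq.w, ← Category.assoc]
    refine ⟨sq.lift _ _ hw, ?_⟩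
    ext1
    · rw [Category.assoc, sq.lift_fst, prod.lift_fst]
    · rw [Category.assoc, sq.lift_snd, prod.lift_snd]

/-- The components of a kernel pair are fibre products. -/
lemma isPullback_relComponent {I : Type*} (U : I → D) [HasCoproduct U] {R F : D}
    {r : R ⟶ (∐ U) ⨯ (∐ U)} {π : ∐ U ⟶ F} (sq : IsPullback (r ≫ prod.fst) (r ≫ prod.snd) π π)
    (i j : I) : IsPullback (relComponentMap U r i j ≫ prod.fst) (relComponentMap U r i j ≫ prod.snd)
      (Limits.Sigma.ι U i ≫ π) (Limits.Sigma.ι U j ≫ π) := by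
  have h1 : (relComponentMap U r i j ≫ prod.fst) ≫ Limits.Sigma.ι U i =
      pullback.fst r _ ≫ r ≫ prod.fst := by
    rw [pullback.condition_assoc, prod.map_fst, Category.assoc]
  have h2 : (relComponentMap U r i j ≫ prod.snd) ≫ Limits.Sigma.ι U j =
      pullback.fst r _ ≫ r ≫ prod.snd := by
    rw [pullback.condition_assoc, prod.map_snd, Category.assoc]
  have hr : ∀ {Z : D} {a b : Z ⟶ R}, a ≫ r = b ≫ r → a = b := fun {Z a b} h =>
    sq.hom_ext (by rw [reassoc_of% h]) (by rw [reassoc_of% h])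
  refine ⟨⟨by
      rw [← Category.assoc, h1, ← Category.assoc _ _ π, h2, Category.assoc, sq.w,
        ← Category.assoc]⟩,
    ⟨PullbackCone.IsLimit.mk _ (fun s => pullback.lift
      (sq.lift (s.fst ≫ Limits.Sigma.ι U i) (s.snd ≫ Limits.Sigma.ι U j)
        (by simpa using s.condition)) (prod.lift s.fst s.snd) ?_) ?_ ?_ ?_⟩⟩
  · have e1 := sq.lift_fst (s.fst ≫ Limits.Sigma.ι U i) (s.snd ≫ Limits.Sigma.ι U j)
      (by simpa using s.condition)
    have e2 := sq.lift_snd (s.fst ≫ Limits.Sigma.ι U i) (s.snd ≫ Limits.Sigma.ι U j)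
      (by simpa using s.condition)
    ext
    · rw [Category.assoc, e1, prod.lift_map, prod.lift_fst]
    · rw [Category.assoc, e2, prod.lift_map, prod.lift_snd]
  · intro s
    rw [pullback.lift_snd_assoc, prod.lift_fst]
  · intro s
    rw [pullback.lift_snd_assoc, prod.lift_snd]
  · intro s m hm1 hm2
    have hm : m ≫ relComponentMap U r i j = prod.lift s.fst s.snd := by
      ext
      · rw [Category.assoc, hm1, prod.lift_fst]
      · rw [Category.assoc, hm2, prod.lift_snd]
    apply pullback.hom_ext
    · rw [pullback.lift_fst]
      apply hr
      rw [Category.assoc, pullback.condition, reassoc_of% hm]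
      ext
      · rw [Category.assoc, Category.assoc, sq.lift_fst, prod.map_fst, prod.lift_fst_assoc]
      · rw [Category.assoc, Category.assoc, sq.lift_snd, prod.map_snd, prod.lift_snd_assoc]
    · rw [pullback.lift_snd, hm]

end KernelPairs

/-! ### Schemes and quotients by equivalence relations -/

section Schemes

lemma isRegularEpi_of_epi_aux {D : Type u} [Category.{v} D] (J : GrothendieckTopology D)
    [HasSheafify J (Type u')] {F G : Sheaf J (Type u')} (π : F ⟶ G) [Epi π] : IsRegularEpi π :=
  IsRegularEpiCategory.regularEpiOfEpi π

variable {C : Type u} [Category.{v} C] [MonoidalCategory C] [SymmetricCategory C]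
  {M : Type u'} [Category.{v'} M] [MonoidalLeftAction C M] [HasCoequalizers M]
  [∀ c : C, PreservesColimitsOfShape WalkingParallelPair (MonoidalLeftAction.actionLeft M c)]
  [IsSubcanonical C M]

lemma IsZariskiOpen.of_iso {X : Aff C} {F F' : SpectralSheaf C M} {j : F ⟶ (affine C M).obj X}
    {j' : F' ⟶ (affine C M).obj X} (h : IsZariskiOpen j) (e : F' ≅ F) (he : e.hom ≫ j = j') :
    IsZariskiOpen j' := by
  obtain ⟨hj, I, Y, α, hα, p, hp, hpj⟩ := h
  refine ⟨he ▸ mono_comp _ _, I, Y, α, hα, p ≫ e.inv, epi_comp _ _, ?_⟩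
  rw [← he, Category.assoc, Iso.inv_hom_id_assoc, hpj]

/-- Zariski open immersions are stable under base change. -/
lemma IsZariskiOpenImmersion.of_isPullback {F G F' G' : SpectralSheaf C M} {f : F ⟶ G}
    {p : F' ⟶ F} {f' : F' ⟶ G'} {q : G' ⟶ G} (h : IsZariskiOpenImmersion f)
    (sq : IsPullback p f' f q) : IsZariskiOpenImmersion f' := by
  intro X x
  have sq' := (IsPullback.of_hasPullback f' x).paste_horiz sq
  exact (h X (x ≫ q)).of_iso sq'.isoPullback sq'.isoPullback_hom_snd

/-- Zariski open immersions are monomorphisms. -/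
lemma IsZariskiOpenImmersion.mono {F G : SpectralSheaf C M} {f : F ⟶ G}
    (h : IsZariskiOpenImmersion f) : Mono f where
  right_cancellation {Z} a b hab := by
    apply GrothendieckTopology.hom_ext_uliftYoneda.{max u v} (spectralTopology C M)
    intro X x
    have hm := (h X (x ≫ a ≫ f)).1
    -- The points `x ≫ a` and `x ≫ b` of `F` lie over the same point of `G`, so they give two
    -- sections of a projection that is mono.
    have h1 : pullback.lift (f := f) (g := x ≫ a ≫ f) (x ≫ a) (𝟙 _) (by simp) =
        pullback.lift (x ≫ b) (𝟙 _) (by simp [hab]) := by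
      rw [← cancel_mono (pullback.snd f (x ≫ a ≫ f)), pullback.lift_snd, pullback.lift_snd]
    have h2 := h1 =≫ pullback.fst _ _
    rwa [pullback.lift_fst, pullback.lift_fst] at h2

/-- The quotient presentation of an `M`-scheme. -/
lemma IsAffineZariskiCovering.exists_presentation {F : SpectralSheaf C M} {I : Type (max u v)}
    {U : I → Aff C} {f : ∀ i, (affine C M).obj (U i) ⟶ F} (hf : IsAffineZariskiCovering f) :
    ∃ (R : SpectralSheaf C M) (r : R ⟶ (∐ fun i => (affine C M).obj (U i)) ⨯
          (∐ fun i => (affine C M).obj (U i))),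
      IsEquivalenceRelation r ∧
      (∀ i j, IsZariskiOpenImmersion
        (relComponentMap (fun i => (affine C M).obj (U i)) r i j ≫ prod.fst)) ∧
      (∀ i, ∃ e : (affine C M).obj (U i) ≅
          relComponent (fun i => (affine C M).obj (U i)) r i i,
        e.hom ≫ relComponentMap (fun i => (affine C M).obj (U i)) r i i =
          diag ((affine C M).obj (U i))) ∧
      Nonempty (F ≅ coequalizer (r ≫ prod.fst) (r ≫ prod.snd)) := by
  have := hf.epi
  let π := Limits.Sigma.desc f
  have sq : IsPullback (prod.lift (pullback.fst π π) (pullback.snd π π) ≫ prod.fst)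
      (prod.lift (pullback.fst π π) (pullback.snd π π) ≫ prod.snd) π π := by
    rw [prod.lift_fst, prod.lift_snd]
    exact IsPullback.of_hasPullback π π
  have hι : ∀ i, Limits.Sigma.ι _ i ≫ π = f i := fun i => Limits.Sigma.ι_desc _ _
  have sq' := isPullback_relComponent (fun i => (affine C M).obj (U i)) sq
  simp only [hι] at sq'
  refine ⟨pullback π π, prod.lift (pullback.fst π π) (pullback.snd π π),
    isEquivalenceRelation_of_isPullback sq, fun i j => ?_, fun i => ?_, ?_⟩
  -- The projection to `U i` is the base change of the other member `f j`, hence the flipped square.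
  · exact (hf.openImmersion j).of_isPullback (sq' i j).flip
  · have hm := (hf.openImmersion i).mono
    -- As `f i` is mono, the two projections of `R i i` agree, so either one is inverse to the
    -- diagonal.
    have h := (cancel_mono (f i)).mp (sq' i i).w
    refine ⟨⟨(sq' i i).lift (𝟙 _) (𝟙 _) rfl, relComponentMap _ _ i i ≫ prod.fst, ?_, ?_⟩, ?_⟩
    · exact (sq' i i).lift_fst _ _ _
    · apply (sq' i i).hom_ext
      · rw [Category.assoc, (sq' i i).lift_fst, Category.comp_id, Category.id_comp]
      · rw [Category.assoc, (sq' i i).lift_snd, Category.comp_id, Category.id_comp, h]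
    · ext1
      · rw [Category.assoc, (sq' i i).lift_fst, prod.lift_fst]
      · rw [Category.assoc, (sq' i i).lift_snd, prod.lift_snd]
  · have hr : IsRegularEpi π := isRegularEpi_of_epi_aux.{v, max u v, max u v} _ π
    have hc := IsKernelPair.toCoequalizer' sq
    exact ⟨(hc.coconePointUniqueUpToIso (coequalizerIsCoequalizer _ _) :)⟩

/-- The quotient of a sheaf by an equivalence relation has this relation as its kernel pair. -/
lemma IsEquivalenceRelation.isPullback {R H F : SpectralSheaf C M} {r : R ⟶ H ⨯ H}
    (hr : IsEquivalenceRelation r) {π : H ⟶ F} (hπ : (r ≫ prod.fst) ≫ π = (r ≫ prod.snd) ≫ π)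
    (hc : IsColimit (Cofork.ofπ π hπ)) : IsPullback (r ≫ prod.fst) (r ≫ prod.snd) π π := by
  have hm := hr.mono
  have sq : IsPullback (prod.lift (pullback.fst π π) (pullback.snd π π) ≫ prod.fst)
      (prod.lift (pullback.fst π π) (pullback.snd π π) ≫ prod.snd) π π := by
    rw [prod.lift_fst, prod.lift_snd]
    exact IsPullback.of_hasPullback π π
  let t : R ⟶ pullback π π := pullback.lift _ _ hπ
  have ht : t ≫ prod.lift (pullback.fst π π) (pullback.snd π π) = r := by
    ext1
    · rw [Category.assoc, prod.lift_fst, pullback.lift_fst]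
    · rw [Category.assoc, prod.lift_snd, pullback.lift_snd]
  have : Mono t := by
    have : Mono (t ≫ prod.lift (pullback.fst π π) (pullback.snd π π)) := by rwa [ht]
    exact mono_of_mono t (prod.lift (pullback.fst π π) (pullback.snd π π))
  -- A point of the kernel pair is a pair identified by `π`, so effectivity lifts it to `R`, without
  -- passing to a cover.
  have : Epi t := by
    refine epi_of_locally_lift.{v, max u v, max u v} t fun X x =>
      ⟨⊤, GrothendieckTopology.top_mem _ _, fun Y g _ => ?_⟩
    obtain ⟨z, hz⟩ := IsEquivalenceRelation.exists_lift.{v, max u v, max u v}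
      (fun P => isLocallyInjective_toSheafify_of_max.{v, max u v} (spectralTopology C M) P) hr hπ hc
      (x := (affine C M).map g ≫ x ≫ pullback.fst π π)
      (x' := (affine C M).map g ≫ x ≫ pullback.snd π π) (by
        simp only [Category.assoc]
        rw [pullback.condition])
    refine ⟨z, ?_⟩
    have := (isEquivalenceRelation_of_isPullback sq).mono
    rw [← cancel_mono (prod.lift (pullback.fst π π) (pullback.snd π π)), Category.assoc, ht, hz,
      prod.comp_lift]
    simp only [Category.assoc]
  have : IsIso t := isIso_of_mono_of_epi t
  exact IsPullback.of_iso_pullback ⟨hπ⟩ (asIso t) (pullback.lift_fst _ _ _)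
    (pullback.lift_snd _ _ _)

variable [MonoidalClosed C] [HasCoequalizers C]
  [∀ m : M, PreservesColimitsOfShape WalkingParallelPair (MonoidalLeftAction.actionRight C m)]

/-- A jointly epimorphic family of monomorphisms from affine schemes whose mutual fibre products
are Zariski open consists of Zariski open immersions. -/
lemma isZariskiOpenImmersion_of_isPullback {F : SpectralSheaf C M} {I : Type (max u v)}
    {U : I → SpectralSheaf C M} (f : ∀ i, U i ⟶ F) [Epi (Limits.Sigma.desc f)] (i : I)
    [Mono (f i)] {R : I → SpectralSheaf C M} {p : ∀ j, R j ⟶ U j} {q : ∀ j, R j ⟶ U i}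
    (sq : ∀ j, IsPullback (p j) (q j) (f j) (f i)) (hp : ∀ j, IsZariskiOpenImmersion (p j)) :
    IsZariskiOpenImmersion (f i) := by
  intro X x
  refine ⟨inferInstance, ?_⟩
  obtain ⟨S, hS, hx⟩ := locally_lift_of_epi_sigmaDesc.{v, max u v, max u v} f x
  -- Only the spectral members of the sieve are kept: they still generate a cover, and immersions
  -- into `Y` remain immersions after composition to `X`.
  let K : Type (max u v) := Σ Y : Aff C, {g : Y ⟶ X // spectralPart M S g}
  choose j z hz using fun k : K => hx k.2.1 k.2.2.1
  -- For each `k : K`, the preimage of `U i` in its source is the image of the spectral immersions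
  -- `α k l`.
  choose hm L Z α hα s hs hsq using fun k : K => hp (j k) k.1 (z k)
  let t (k : K) : pullback (p (j k)) (z k) ⟶ pullback (f i) x :=
    pullback.lift (pullback.fst _ _ ≫ q (j k)) (pullback.snd _ _ ≫ (affine C M).map k.2.1) (by
      rw [Category.assoc, ← (sq (j k)).w, pullback.condition_assoc, hz, Category.assoc])
  -- A point of the preimage of `U i` in `X` lies over some `c` into `X`. Where `c` factors through
  -- a member of `K`, the lift to `U (j k)` and the point of `U i` agree in `F`, so they define a
  -- point of `R (j k)`.
  have ht : Epi (Limits.Sigma.desc t) := by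
    apply epi_sigmaDesc_of_locally_lift.{v, max u v, max u v}
    intro X' x'
    obtain ⟨c, hc⟩ := (affine C M).map_surjective (x' ≫ pullback.snd (f i) x)
    refine ⟨_, (spectralTopology C M).pullback_stable c (generate_spectralPart_mem hS), ?_⟩
    rintro Y' g' ⟨Y, b, g, hg, hw⟩
    let k : K := ⟨Y, g, hg⟩
    have h1 : (affine C M).map b ≫ (affine C M).map g =
        (affine C M).map g' ≫ x' ≫ pullback.snd (f i) x := by
      rw [← hc, ← Functor.map_comp, ← Functor.map_comp, hw]
    have h2 : ((affine C M).map b ≫ z k) ≫ f (j k) =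
        ((affine C M).map g' ≫ x' ≫ pullback.fst (f i) x) ≫ f i := by
      simp only [Category.assoc]
      rw [hz k, pullback.condition, reassoc_of% h1]
    refine ⟨k, pullback.lift ((sq (j k)).lift _ _ h2) ((affine C M).map b)
      ((sq (j k)).lift_fst _ _ h2), ?_⟩
    apply pullback.hom_ext
    · rw [Category.assoc, Category.assoc, pullback.lift_fst, pullback.lift_fst_assoc,
        (sq (j k)).lift_snd]
    · rw [Category.assoc, Category.assoc, pullback.lift_snd, pullback.lift_snd_assoc]
      exact h1
  refine ⟨Σ k, L k, fun kl => Z kl.1 kl.2, fun kl => α kl.1 kl.2 ≫ kl.1.2.1,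
    fun kl => (hα kl.1 kl.2).comp kl.1.2.2.2,
    Limits.Sigma.desc fun kl => Limits.Sigma.ι (fun l => (affine C M).obj (Z kl.1 l)) kl.2 ≫
      s kl.1 ≫ t kl.1, ⟨fun {G} a b hab => ?_⟩, ?_⟩
  · rw [← cancel_epi (Limits.Sigma.desc t)]
    ext1 k
    rw [Limits.Sigma.ι_desc_assoc, Limits.Sigma.ι_desc_assoc]
    have := hs k
    rw [← cancel_epi (s k)]
    ext1 l
    have := Limits.Sigma.ι (fun kl : Σ k, L k => (affine C M).obj (Z kl.1 kl.2)) ⟨k, l⟩ ≫= hab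
    rw [Limits.Sigma.ι_desc_assoc, Limits.Sigma.ι_desc_assoc] at this
    simpa only [Category.assoc] using this
  · ext1 ⟨k, l⟩
    have h1 : t k ≫ pullback.snd (f i) x = pullback.snd _ _ ≫ (affine C M).map k.2.1 :=
      pullback.lift_snd _ _ _
    rw [Limits.Sigma.ι_desc_assoc, Limits.Sigma.ι_desc, Category.assoc, Category.assoc, h1,
      reassoc_of% (hsq k), Limits.Sigma.ι_desc_assoc, Functor.map_comp]

/-- The quotient of a disjoint union of affine schemes by an equivalence relation with Zariski open
components and trivial diagonal components is a scheme. -/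
lemma IsEquivalenceRelation.isScheme {F : SpectralSheaf C M} {I : Type (max u v)} {U : I → Aff C}
    {R : SpectralSheaf C M} {r : R ⟶ (∐ fun i => (affine C M).obj (U i)) ⨯
      (∐ fun i => (affine C M).obj (U i))} (hr : IsEquivalenceRelation r)
    (hopen : ∀ i j, IsZariskiOpenImmersion
      (relComponentMap (fun i => (affine C M).obj (U i)) r i j ≫ prod.fst))
    (hdiag : ∀ i, ∃ e : (affine C M).obj (U i) ≅
        relComponent (fun i => (affine C M).obj (U i)) r i i,
      e.hom ≫ relComponentMap (fun i => (affine C M).obj (U i)) r i i =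
        diag ((affine C M).obj (U i)))
    (φ : F ≅ coequalizer (r ≫ prod.fst) (r ≫ prod.snd)) : IsScheme F := by
  let π := coequalizer.π (r ≫ prod.fst) (r ≫ prod.snd) ≫ φ.inv
  have hπ : (r ≫ prod.fst) ≫ π = (r ≫ prod.snd) ≫ π := coequalizer.condition_assoc _ _ _
  have hc : IsColimit (Cofork.ofπ π hπ) :=
    (coequalizerIsCoequalizer (r ≫ prod.fst) (r ≫ prod.snd)).ofIsoColimit
      (Cofork.ext φ.symm rfl)
  have sq := isPullback_relComponent (fun i => (affine C M).obj (U i)) (hr.isPullback hπ hc)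
  have hepi : Epi π := Cofork.IsColimit.epi hc
  have hdesc : (Limits.Sigma.desc fun i => Limits.Sigma.ι (fun i => (affine C M).obj (U i)) i ≫ π) =
      π := by
    ext1 i
    exact Limits.Sigma.ι_desc _ _
  have hepi' : Epi (Limits.Sigma.desc fun i =>
      Limits.Sigma.ι (fun i => (affine C M).obj (U i)) i ≫ π) := by rwa [hdesc]
  have hmono : ∀ i, Mono (Limits.Sigma.ι (fun i => (affine C M).obj (U i)) i ≫ π) := fun i =>
    ⟨fun {Z} g h hgh => by
      obtain ⟨e, he⟩ := hdiag i
      -- The diagonal condition equalizes the two projections of `R i i`, which is the kernel pair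
      -- of `U i ⟶ F`; so that map is mono.
      have h1 : relComponentMap (fun i => (affine C M).obj (U i)) r i i ≫ prod.fst =
          relComponentMap (fun i => (affine C M).obj (U i)) r i i ≫ prod.snd := by
        rw [← cancel_epi e.hom, reassoc_of% he, reassoc_of% he, prod.lift_fst, prod.lift_snd]
      exact ((sq i i).lift_fst g h hgh).symm.trans
        ((congrArg _ h1).trans ((sq i i).lift_snd g h hgh))⟩
  exact ⟨I, U, _, fun i => isZariskiOpenImmersion_of_isPullback _ i (fun j => sq j i)
    (fun j => hopen j i), hepi'⟩

end Schemes

end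
end RelScheme

theorem mainTheorem3
    {C : Type u} [Category.{v} C] [MonoidalCategory C] [SymmetricCategory C] [MonoidalClosed C]
    [HasLimits C] [HasColimits C]
    {M : Type u'} [Category.{v'} M] [MonoidalLeftAction C M] [HasLimits M] [HasColimits M]
    [∀ c : C, PreservesColimits (MonoidalLeftAction.actionLeft M c)]
    [∀ m : M, PreservesColimitsOfSize.{v, v} (MonoidalLeftAction.actionRight C m)]
    [RelScheme.IsSubcanonical C M] (F : RelScheme.SpectralSheaf C M) :
    RelScheme.IsScheme F ↔
      ∃ (I : Type (max u v)) (U : I → RelScheme.Aff C) (R : RelScheme.SpectralSheaf C M)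
        (r : R ⟶ (∐ fun i => (RelScheme.affine C M).obj (U i)) ⨯
          (∐ fun i => (RelScheme.affine C M).obj (U i))),
        RelScheme.IsEquivalenceRelation r ∧
        (∀ i j, RelScheme.IsZariskiOpenImmersion
          (RelScheme.relComponentMap (fun i => (RelScheme.affine C M).obj (U i)) r i j ≫
            prod.fst)) ∧
        (∀ i, ∃ e : (RelScheme.affine C M).obj (U i) ≅
            RelScheme.relComponent (fun i => (RelScheme.affine C M).obj (U i)) r i i,
          e.hom ≫ RelScheme.relComponentMap (fun i => (RelScheme.affine C M).obj (U i)) r i i =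
            diag ((RelScheme.affine C M).obj (U i))) ∧
        Nonempty (F ≅ coequalizer (r ≫ prod.fst) (r ≫ prod.snd)) := by
  -- Coequalizers have a shape in universe `0`, so the assumption at size `v` is lowered to that
  -- size.
  have (m : M) : PreservesColimitsOfSize.{0, 0} (MonoidalLeftAction.actionRight C m) :=
    preservesColimitsOfSize_shrink.{0, v, 0, v} _
  constructor
  · rintro ⟨I, U, f, hf⟩
    exact ⟨I, U, hf.exists_presentation⟩
  · rintro ⟨I, U, R, r, hr, hopen, hdiag, ⟨φ⟩⟩
    exact hr.isScheme hopen hdiag φ
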